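/- Let $n\ge 3$ be an integer, let $\delta\in\mathbb{C}$, and let $p_n(z)=z^n-1$. Consider the rational map $T_{p_n,\delta}:\hat{\mathbb C}\to\hat{\mathbb C}$ of the Riemann sphere $\hat{\mathbb C}=\mathbb C\cup\{\infty\}$ given by $$T_{p_n,\delta}(z)=N_{p_n}(z)-\delta\,\frac{p_n(N_{p_n}(z))}{p_n'(z)},\qquad N_{p_n}(z)=z-\frac{p_n(z)}{p_n'(z)}$$ (the damped Traub map of $p_n$). For $\xi\in\mathbb C$ with $\xi^n=1$, let $\mathcal A(\xi)=\{z\in\hat{\mathbb C} : T_{p_n,\delta}^k(z)\to\xi \text{ as } k\to\infty\}$, where $T_{p_n,\delta}^k$ is the $k$-th iterate, and let the immediate basin $\mathcal A^\star(\xi)$ be the connected component of $\mathcal A(\xi)$ that contains $\xi$. Then, for every $n$-th root of unity $\xi$, the set $\mathcal A^\star(\xi)$ is simply connected. -/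

import Mathlib

open Polynomial Filter Topology

noncomputable section

/-- The map of the Riemann sphere `ℂ ∪ {∞}` induced by a rational function `R = num / denom`
(in lowest terms): a zero of the denominator is a pole and is sent to `∞`, and `∞` is sent to
the limit of `R` at infinity. -/
def sphereMap (R : RatFunc ℂ) : OnePoint ℂ → OnePoint ℂ
  | OnePoint.some z =>
      open Classical in
      if R.denom.eval z = 0 then OnePoint.infty
      else ((R.num.eval z / R.denom.eval z : ℂ) : OnePoint ℂ)
  | OnePoint.infty =>
      if R.denom.natDegree < R.num.natDegree then OnePoint.infty
      else ((R.num.coeff R.denom.natDegree / R.denom.leadingCoeff : ℂ) : OnePoint ℂ)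

/-- The basin of attraction of `ξ` under `R`, a subset of the Riemann sphere. -/
def basin (R : RatFunc ℂ) (ξ : OnePoint ℂ) : Set (OnePoint ℂ) :=
  {z | Tendsto (fun k : ℕ => (sphereMap R)^[k] z) atTop (𝓝 ξ)}

/-- The immediate basin of `ξ`: the connected component of the basin that contains `ξ`. -/
def immediateBasin (R : RatFunc ℂ) (ξ : OnePoint ℂ) : Set (OnePoint ℂ) :=
  connectedComponentIn (basin R ξ) ξ

/-- Newton's map `N_p(z) = z - p(z) / p'(z)` as a rational function. -/
def newtonRatFunc (p : ℂ[X]) : RatFunc ℂ :=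
  RatFunc.X - algebraMap ℂ[X] (RatFunc ℂ) p / algebraMap ℂ[X] (RatFunc ℂ) (derivative p)

/-- The damped Traub map `T_{p,δ}(z) = N_p(z) - δ p(N_p(z)) / p'(z)` as a rational function. -/
def dampedTraub (p : ℂ[X]) (δ : ℂ) : RatFunc ℂ :=
  newtonRatFunc p - RatFunc.C δ * (aeval (newtonRatFunc p) p /
    algebraMap ℂ[X] (RatFunc ℂ) (derivative p))

end

/-! Write `t` for the map on the plane. It commutes with the rotation by a primitive `n`-th root of
unity `ω`, and `0` and `∞` are the only points of the sphere fixed by that rotation. Hence `{0, ∞}`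
is mapped into itself, and an orbit that converges to `ξ` never meets it. All poles lie in `{0, ∞}`,
so the basin is an open subset of the punctured plane on which all iterates are holomorphic
(`sphereMap_zero_infty`, `basin_eq_image_planeBasin`).

Let `K` be a continuum in the immediate basin and `V` a bounded component of its complement. If some
iterate vanishes in `V`, then the first such iterate sends `K` to a continuum `σ` in the basin that
surrounds `0`. The copy `ω • σ` lies in the basin of `ω ξ`, so it misses `σ`; but a rotation about
`0` preserves moduli, so neither of the two can lie inside the other
(`not_isBounded_component_zero`). Therefore every iterate is holomorphic on `V`, and the maximum
principle carries the convergence to `ξ` from `K` over to `V`. The immediate basin thus has no holes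
(`fillsHoles_component_planeBasin`).

That a plane domain without holes is simply connected (`FillsHoles.isSimplyConnected`) is shown on a
fine square lattice. A loop becomes a closed lattice walk, which is reduced at its lexicographically
largest vertex by splitting it, deleting a back-and-forth, or pushing a corner across a square. The
square lies in the domain: a point of it outside the domain would be in the unbounded part of the
complement of the walk, so `x - w` would have a continuous logarithm on the walk, against the jump
of the argument at the corner. -/

/-! ### Reduction of closed lattice walks -/

/-- The product of the values of `φ` on consecutive pairs of a list. -/
def walkProd {V G : Type*} [Monoid G] (φ : V → V → G) : List V → G
  | a :: b :: l => φ a b * walkProd φ (b :: l)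
  | _ => 1

section WalkProd

variable {V G : Type*} [Group G] {φ : V → V → G}

@[simp] theorem walkProd_singleton (a : V) : walkProd φ [a] = 1 := rfl

@[simp] theorem walkProd_cons_cons (a b : V) (l : List V) :
    walkProd φ (a :: b :: l) = φ a b * walkProd φ (b :: l) := rfl

theorem walkProd_append_cons (s : List V) (b : V) (t : List V) :
    walkProd φ (s ++ b :: t) = walkProd φ (s ++ [b]) * walkProd φ (b :: t) := by
  induction s with
  | nil => simp
  | cons a s ih =>
    cases s with
    | nil => simp
    | cons c s => simpa [mul_assoc] using ih

theorem walkProd_cons_rotate {a v : V} {s t : List V}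
    (h : walkProd φ (v :: (t ++ a :: s) ++ [v]) = 1) :
    walkProd φ (a :: (s ++ v :: t) ++ [a]) = 1 := by
  have h1 := walkProd_append_cons (φ := φ) (a :: s) v (t ++ [a])
  have h2 := walkProd_append_cons (φ := φ) (v :: t) a (s ++ [v])
  simp only [List.cons_append, List.append_assoc] at h1 h2 h ⊢
  rw [h1]
  rw [h2] at h
  exact mul_eq_one_comm.mp h

theorem isChain_cons_rotate {E : V → V → Prop} {a v : V} {s t : List V}
    (h : List.IsChain E (a :: (s ++ v :: t) ++ [a])) :
    List.IsChain E (v :: (t ++ a :: s) ++ [v]) := by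
  have h1 : List.IsChain E ((a :: s) ++ v :: (t ++ [a])) := by simpa using h
  have h2 := List.isChain_split.mp h1
  have : List.IsChain E ((v :: t) ++ a :: (s ++ [v])) :=
    List.isChain_split.mpr ⟨by simpa using h2.2, by simpa using h2.1⟩
  simpa using this

end WalkProd

/-- The weight of a lattice point in the quadrant with lower left corner `o`. -/
def latticeWeight (o v : ℤ × ℤ) : ℕ := 1 + (v.1 - o.1).toNat + (v.2 - o.2).toNat

/-- The vertical-then-horizontal lexicographic order of the lattice. -/
def LexBelow (u v : ℤ × ℤ) : Prop := u.2 < v.2 ∨ (u.2 = v.2 ∧ u.1 < v.1)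

theorem exists_lexBelow_max (l : List (ℤ × ℤ)) (hl : l ≠ []) :
    ∃ v ∈ l, ∀ u ∈ l, u ≠ v → LexBelow u v := by
  obtain ⟨v, hv, h⟩ := l.toFinset.exists_max_image (fun v => toLex (v.2, v.1))
    (List.toFinset_nonempty_iff l |>.mpr hl)
  refine ⟨v, by simpa using hv, fun u hu huv => ?_⟩
  have := h u (by simpa using hu)
  rw [Prod.Lex.le_iff] at this
  simp only [ofLex_toLex] at this
  rcases this with h1 | ⟨h1, h2⟩
  · exact Or.inl h1
  · refine Or.inr ⟨h1, lt_of_le_of_ne h2 fun h3 => huv (Prod.ext h3 h1)⟩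

/-- Two lattice points are equal or neighbours. -/
def LatticeAdj (a b : ℤ × ℤ) : Prop :=
  (a.1 = b.1 ∧ |a.2 - b.2| ≤ 1) ∨ (a.2 = b.2 ∧ |a.1 - b.1| ≤ 1)

/-- A group-valued function on lattice edges has trivial product along every closed walk, if it
is trivial on back-and-forth walks and on the square below every extreme corner. -/
theorem walkProd_closed_eq_one {G : Type*} [Group G] {φ : ℤ × ℤ → ℤ × ℤ → G}
    {E : ℤ × ℤ → ℤ × ℤ → Prop} (hadj : ∀ a b, E a b → LatticeAdj a b)
    (hself : ∀ a, E a a → φ a a = 1) (hinv : ∀ a b, E a b → φ a b * φ b a = 1)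
    (hcorner : ∀ v : ℤ × ℤ, ∀ s : List (ℤ × ℤ), List.IsChain E (v :: s ++ [v]) →
      (∀ u ∈ s, LexBelow u v) → (v.1 - 1, v.2) ∈ s → (v.1, v.2 - 1) ∈ s →
      E (v.1 - 1, v.2) v → E v (v.1, v.2 - 1) →
        E (v.1 - 1, v.2) (v.1 - 1, v.2 - 1) ∧ E (v.1 - 1, v.2 - 1) (v.1, v.2 - 1) ∧
        φ (v.1 - 1, v.2) v * φ v (v.1, v.2 - 1) =
          φ (v.1 - 1, v.2) (v.1 - 1, v.2 - 1) * φ (v.1 - 1, v.2 - 1) (v.1, v.2 - 1))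
    (hsymm : ∀ a b, E a b → E b a)
    (o : ℤ × ℤ) (a : ℤ × ℤ) (s : List (ℤ × ℤ)) (ho : ∀ u ∈ a :: s, o.1 ≤ u.1 ∧ o.2 ≤ u.2)
    (hs : List.IsChain E (a :: s ++ [a])) :
    walkProd φ (a :: s ++ [a]) = 1 := by
  -- Induction on total weight. The summand `1` in `latticeWeight` makes deleting a vertex lower it;
  -- a corner flip lowers it by `2`.
  induction hM : ((a :: s).map (latticeWeight o)).sum using Nat.strong_induction_on
    generalizing a s with
  | _ M ih =>
  obtain ⟨v, hv, hmax⟩ := exists_lexBelow_max (a :: s) (by simp)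
  -- rotate the walk so that it starts at the extreme vertex
  suffices H : ∀ t : List (ℤ × ℤ), (∀ u ∈ v :: t, o.1 ≤ u.1 ∧ o.2 ≤ u.2) →
      (∀ u ∈ v :: t, u ≠ v → LexBelow u v) →
      List.IsChain E (v :: t ++ [v]) → ((v :: t).map (latticeWeight o)).sum = M →
      walkProd φ (v :: t ++ [v]) = 1 by
    obtain ⟨l₁, l₂, hl⟩ := List.append_of_mem hv
    cases l₁ with
    | nil =>
      simp only [List.nil_append, List.cons.injEq] at hl
      obtain ⟨rfl, rfl⟩ := hl
      exact H s ho hmax hs hM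
    | cons b l₁ =>
      simp only [List.cons_append, List.cons.injEq] at hl
      obtain ⟨rfl, rfl⟩ := hl
      refine walkProd_cons_rotate (H _ (fun u hu => ho u ?_) (fun u hu => hmax u ?_)
        (isChain_cons_rotate hs) ?_)
      · simp only [List.mem_cons, List.mem_append] at hu ⊢; tauto
      · simp only [List.mem_cons, List.mem_append] at hu ⊢; tauto
      · rw [← hM]; simp; ring
  clear hv hmax hs ho hM a s
  intro t ho hmax hs hM
  have hpos : ∀ u, 0 < latticeWeight o u := fun u => by unfold latticeWeight; omega
  have hsum : ∀ (u : ℤ × ℤ) (r : List (ℤ × ℤ)), 0 < ((u :: r).map (latticeWeight o)).sum :=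
    fun u r => by simp only [List.map_cons, List.sum_cons]; have := hpos u; omega
  by_cases hvt : v ∈ t
  · -- split at a second visit
    obtain ⟨l₁, l₂, rfl⟩ := List.append_of_mem hvt
    have e : v :: (l₁ ++ v :: l₂) ++ [v] = (v :: l₁) ++ v :: (l₂ ++ [v]) := by simp
    rw [e] at hs ⊢
    obtain ⟨c1, c2⟩ := List.isChain_split.mp hs
    have hM' : ((v :: l₁).map (latticeWeight o)).sum + ((v :: l₂).map (latticeWeight o)).sum
        = M := by rw [← hM]; simp; ring
    have := hsum v l₁
    have := hsum v l₂
    rw [walkProd_append_cons, ih _ (by omega) v l₁ _ c1 rfl]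
    · rw [one_mul]
      exact ih _ (by omega) v l₂ (fun u hu => ho u (by simp at hu ⊢; tauto)) (by simpa using c2) rfl
    · exact fun u hu => ho u (by simp at hu ⊢; tauto)
  · have hlex : ∀ u ∈ t, LexBelow u v := fun u hu =>
      hmax u (by simp [hu]) (fun h => hvt (h ▸ hu))
    cases t with
    | nil =>
      have : E v v := by simpa using hs
      simpa using hself v this
    | cons b t =>
      have hvb : E v b := by simp at hs; exact hs.1
      rcases t.eq_nil_or_concat with rfl | ⟨r, c, rfl⟩
      · simpa using hinv v b hvb
      simp only [List.concat_eq_append] at *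
      have e : v :: (b :: (r ++ [c])) ++ [v] = (v :: b :: r) ++ c :: [v] := by simp
      obtain ⟨c1, c2⟩ := List.isChain_split.mp (e ▸ hs)
      have hcv : E c v := by simpa using c2
      have c1' : List.IsChain E (b :: r ++ [c]) := by simp at c1 ⊢; exact c1.2
      have hprod : walkProd φ (v :: (b :: (r ++ [c])) ++ [v]) =
          φ v b * walkProd φ (b :: r ++ [c]) * φ c v := by
        rw [e, walkProd_append_cons]; simp [mul_assoc]
      by_cases hbc : b = c
      · -- remove a back-and-forth
        subst hbc
        rw [hprod, ih _ _ b r _ c1' rfl]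
        · simpa using hinv v b hvb
        · have h1 := hpos b
          have h2 := hpos v
          simp only [List.map_cons, List.map_append, List.sum_cons, List.sum_append,
            List.map_nil, List.sum_nil] at hM ⊢
          omega
        · exact fun u hu => ho u (by simp at hu ⊢; tauto)
      · -- flip a corner
        have hb := hlex b (by simp)
        have hc := hlex c (by simp)
        have ob := ho b (by simp)
        have oc := ho c (by simp)
        have ov := ho v (by simp)
        set L : ℤ × ℤ := (v.1 - 1, v.2) with hL
        set B : ℤ × ℤ := (v.1, v.2 - 1) with hB
        set Q : ℤ × ℤ := (v.1 - 1, v.2 - 1) with hQ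
        -- Since `v` is extreme, the walk can reach and leave it only on the left or from below.
        have key : ∀ u, LexBelow u v → LatticeAdj u v → u = L ∨ u = B := by
          intro u hu hu'
          simp only [LexBelow, LatticeAdj, abs_le, hL, hB, Prod.ext_iff] at hu hu' ⊢
          omega
        have hbLB := key b hb (hadj b v (hsymm _ _ hvb))
        have hcLB := key c hc (hadj c v hcv)
        have hcase : (b = L ∧ c = B) ∨ (b = B ∧ c = L) := by
          rcases hbLB with h1 | h1 <;> rcases hcLB with h2 | h2
          · exact absurd (h1.trans h2.symm) hbc
          · exact Or.inl ⟨h1, h2⟩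
          · exact Or.inr ⟨h1, h2⟩
          · exact absurd (h1.trans h2.symm) hbc
        have hLm : L ∈ b :: (r ++ [c]) := by
          rcases hcase with ⟨h1, h2⟩ | ⟨h1, h2⟩ <;> simp [h1, h2]
        have hBm : B ∈ b :: (r ++ [c]) := by
          rcases hcase with ⟨h1, h2⟩ | ⟨h1, h2⟩ <;> simp [h1, h2]
        have hLv : E L v := by
          rcases hcase with ⟨h1, h2⟩ | ⟨h1, h2⟩
          · exact h1 ▸ hsymm _ _ hvb
          · exact h2 ▸ hcv
        have hvB : E v B := by
          rcases hcase with ⟨h1, h2⟩ | ⟨h1, h2⟩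
          · exact h2 ▸ hsymm _ _ hcv
          · exact h1 ▸ hvb
        obtain ⟨hLQ, hQB, hφ⟩ := hcorner v _ hs hlex hLm hBm hLv hvB
        have hinv' : ∀ x y, E x y → φ y x = (φ x y)⁻¹ := fun x y h =>
          eq_inv_of_mul_eq_one_right (hinv x y h)
        have hflip : φ c v * φ v b = φ c Q * φ Q b ∧ E c Q ∧ E Q b := by
          rcases hcase with ⟨h1, h2⟩ | ⟨h1, h2⟩
          · refine ⟨?_, h2 ▸ hsymm _ _ hQB, h1 ▸ hsymm _ _ hLQ⟩
            rw [h1, h2, hinv' _ _ hvB, hinv' _ _ hLv, hinv' _ _ hQB, hinv' _ _ hLQ,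
              ← mul_inv_rev, ← mul_inv_rev, hφ]
          · exact ⟨by rw [h1, h2, hφ], h2 ▸ hLQ, h1 ▸ hQB⟩
        have hnew : walkProd φ (Q :: (b :: (r ++ [c])) ++ [Q]) = 1 := by
          refine ih _ ?_ Q (b :: (r ++ [c])) ?_ ?_ rfl
          -- Both `L` and `B` lie in the quadrant of `o`, hence so does `Q`, and the truncations by
          -- `toNat` do no harm.
          · have hQw : latticeWeight o Q < latticeWeight o v := by
              rcases hcase with ⟨h1, h2⟩ | ⟨h1, h2⟩ <;>
              · rw [h1] at ob; rw [h2] at oc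
                simp only [latticeWeight, hQ, hL, hB] at ob oc ⊢; omega
            simp only [List.map_cons, List.sum_cons] at hM ⊢
            omega
          · intro u hu
            rcases List.mem_cons.mp hu with rfl | hu
            · rcases hcase with ⟨h1, h2⟩ | ⟨h1, h2⟩ <;>
              · rw [h1] at ob; rw [h2] at oc
                simp only [hQ, hL, hB] at ob oc ⊢; omega
            · exact ho u (by simp at hu ⊢; tauto)
          · have e' : Q :: (b :: (r ++ [c])) ++ [Q] = (Q :: b :: r) ++ c :: [Q] := by simp
            rw [e']
            refine List.isChain_split.mpr ⟨?_, by simpa using hflip.2.1⟩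
            simp at c1' ⊢
            exact ⟨hflip.2.2, c1'⟩
        have e' : Q :: (b :: (r ++ [c])) ++ [Q] = (Q :: b :: r) ++ c :: [Q] := by simp
        rw [e', walkProd_append_cons] at hnew
        simp only [List.cons_append, walkProd_cons_cons, walkProd_singleton, mul_one] at hnew hprod
        change φ v b * walkProd φ (b :: (r ++ [c] ++ [v])) = 1
        rw [hprod]
        rw [mul_assoc] at hnew ⊢
        -- Cyclic rotation brings the edge into the corner next to the edge out of it, so that
        -- `hflip` applies.
        rw [mul_eq_one_comm, mul_assoc] at hnew ⊢
        rw [hflip.1]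
        exact hnew

/-! ### Classes of paths and of straight edges -/

section PathClass

variable {X : Type*} [TopologicalSpace X] {x₀ : X}

/-- The class in the fundamental group (written in order of travel) of a path, closed up by a
chosen system of paths from the base point. -/
noncomputable def pathClass (h : ∀ z : X, Path x₀ z) {a b : X} (p : Path a b) :
    (FundamentalGroup X x₀)ᵐᵒᵖ :=
  .op (FundamentalGroup.fromPath (.mk (((h a).trans p).trans (h b).symm)))

theorem pathClass_congr (h : ∀ z : X, Path x₀ z) {a b : X} {p q : Path a b}
    (hpq : p.Homotopic q) : pathClass h p = pathClass h q := by
  unfold pathClass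
  congr 2
  exact Path.Homotopic.Quotient.eq.mpr
    (Path.Homotopic.hcomp (Path.Homotopic.hcomp (.refl _) hpq) (.refl _))

-- The detour along `h b` and back cancels. The product of `FundamentalGroup` runs against `trans`,
-- hence the opposite group.
open Path.Homotopic.Quotient in
theorem pathClass_trans (h : ∀ z : X, Path x₀ z) {a b c : X} (p : Path a b) (q : Path b c) :
    pathClass h (p.trans q) = pathClass h p * pathClass h q := by
  unfold pathClass
  rw [← MulOpposite.op_mul, FundamentalGroup.mul_def]
  congr 1
  simp only [mk_trans, mk_symm, trans_assoc]
  rw [← trans_assoc (symm (mk (h b))) (mk (h b)), symm_trans, refl_trans]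

open Path.Homotopic.Quotient in
theorem Path.Homotopic.Quotient.eq_refl_of_conj {a : X} (H : Path.Homotopic.Quotient x₀ a)
    (P : Path.Homotopic.Quotient a a) (hP : trans (trans H P) (symm H) = refl x₀) :
    P = refl a := by
  have h1 : trans H P = H := by
    rw [← trans_refl (trans H P), ← symm_trans H, ← trans_assoc, hP, refl_trans]
  rw [← refl_trans P, ← symm_trans H, trans_assoc, h1]

open Path.Homotopic.Quotient in
theorem homotopic_refl_of_pathClass_eq_one (h : ∀ z : X, Path x₀ z) {a : X} {p : Path a a}
    (hp : pathClass h p = 1) : p.Homotopic (Path.refl a) := by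
  rw [← Path.Homotopic.Quotient.eq, mk_refl]
  refine eq_refl_of_conj (mk (h a)) (mk p) ?_
  unfold pathClass at hp
  rw [← MulOpposite.op_one, MulOpposite.op_inj, FundamentalGroup.one_def, mk_trans, mk_trans,
    mk_symm] at hp
  exact hp

end PathClass

theorem Convex.homotopic_of_subset {U K : Set ℂ} (hK : Convex ℝ K) (hKU : K ⊆ U) {x y : U}
    {p q : Path x y} (hp : ∀ t, (p t : ℂ) ∈ K) (hq : ∀ t, (q t : ℂ) ∈ K) : p.Homotopic q := by
  have hx : (x : ℂ) ∈ K := by simpa using hp 0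
  have hy : (y : ℂ) ∈ K := by simpa using hp 1
  have : ContractibleSpace K := hK.contractibleSpace ⟨x, hx⟩
  let p' : Path (⟨x, hx⟩ : K) ⟨y, hy⟩ := ⟨⟨fun t => ⟨p t, hp t⟩, by fun_prop⟩, by simp, by simp⟩
  let q' : Path (⟨x, hx⟩ : K) ⟨y, hy⟩ := ⟨⟨fun t => ⟨q t, hq t⟩, by fun_prop⟩, by simp, by simp⟩
  exact (SimplyConnectedSpace.paths_homotopic p' q').map
    ⟨Set.inclusion hKU, continuous_inclusion hKU⟩

theorem Path.segment_mem_segment (z w : ℂ) (t : unitInterval) :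
    Path.segment z w t ∈ segment ℝ z w := by
  rw [← Path.range_segment]; exact ⟨t, rfl⟩

/-- The straight path between two points of a set that contains the segment. -/
noncomputable def segmentPath {U : Set ℂ} {z w : U} (h : segment ℝ (z : ℂ) w ⊆ U) :
    Path z w where
  toFun t := ⟨Path.segment (z : ℂ) w t, h (Path.segment_mem_segment _ _ t)⟩
  source' := by simp
  target' := by simp

theorem segmentPath_mem {U : Set ℂ} {z w : U} (h : segment ℝ (z : ℂ) w ⊆ U) (t : unitInterval) :
    (segmentPath h t : ℂ) ∈ segment ℝ (z : ℂ) w :=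
  Path.segment_mem_segment _ _ t

section EdgeClass

variable {U : Set ℂ} {x₀ : U} (h : ∀ z : U, Path x₀ z)

open Classical in
/-- The class of the straight path from `z` to `w`, if that path lies in `U`. -/
noncomputable def edgeClass (z w : ℂ) : (FundamentalGroup U x₀)ᵐᵒᵖ :=
  if H : segment ℝ z w ⊆ U then
    pathClass h (segmentPath (z := ⟨z, H (left_mem_segment ℝ z w)⟩)
      (w := ⟨w, H (right_mem_segment ℝ z w)⟩) H)
  else 1

theorem pathClass_eq_edgeClass {K : Set ℂ} (hK : Convex ℝ K) (hKU : K ⊆ U) {a b : U}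
    (p : Path a b) (hp : ∀ t, (p t : ℂ) ∈ K) : pathClass h p = edgeClass h a b := by
  have ha : (a : ℂ) ∈ K := by simpa using hp 0
  have hb : (b : ℂ) ∈ K := by simpa using hp 1
  have hs := hK.segment_subset ha hb
  rw [edgeClass, dif_pos (hs.trans hKU)]
  exact pathClass_congr h (hK.homotopic_of_subset hKU hp fun t =>
    hs (segmentPath_mem (hs.trans hKU) t))

/-- In a convex subset of `U` the broken path and the chord are homotopic. This triangle relation
gives both the square relation and the change from loop points to nearby lattice points. -/
theorem edgeClass_mul {K : Set ℂ} (hK : Convex ℝ K) (hKU : K ⊆ U) {a b c : ℂ} (ha : a ∈ K)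
    (hb : b ∈ K) (hc : c ∈ K) : edgeClass h a b * edgeClass h b c = edgeClass h a c := by
  have hab := hK.segment_subset ha hb
  have hbc := hK.segment_subset hb hc
  let p : Path (⟨a, hKU ha⟩ : U) ⟨b, hKU hb⟩ :=
    segmentPath (hab.trans hKU)
  let q : Path (⟨b, hKU hb⟩ : U) ⟨c, hKU hc⟩ :=
    segmentPath (hbc.trans hKU)
  have hp : ∀ t, (p t : ℂ) ∈ K := fun t => hab (segmentPath_mem
    (z := ⟨a, hKU ha⟩) (w := ⟨b, hKU hb⟩) (hab.trans hKU) t)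
  have hq : ∀ t, (q t : ℂ) ∈ K := fun t => hbc (segmentPath_mem
    (z := ⟨b, hKU hb⟩) (w := ⟨c, hKU hc⟩) (hbc.trans hKU) t)
  have h1 := pathClass_eq_edgeClass h hK hKU p hp
  have h2 := pathClass_eq_edgeClass h hK hKU q hq
  have h3 := pathClass_eq_edgeClass h hK hKU (p.trans q) fun t => by
    have : (p.trans q) t ∈ Set.range (p.trans q) := ⟨t, rfl⟩
    rw [Path.trans_range] at this
    rcases this with ⟨s, hs⟩ | ⟨s, hs⟩
    · rw [← hs]; exact hp s
    · rw [← hs]; exact hq s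
  rw [← h1, ← h2, ← h3, pathClass_trans]

theorem edgeClass_self {a : ℂ} (ha : a ∈ U) : edgeClass h a a = 1 := by
  simpa using edgeClass_mul h (convex_singleton a) (by simpa using ha) (a := a) (b := a) (c := a)
    rfl rfl rfl

theorem edgeClass_mul_symm {a b : ℂ} (hab : segment ℝ a b ⊆ U) :
    edgeClass h a b * edgeClass h b a = 1 := by
  rw [edgeClass_mul h (convex_segment a b) hab (left_mem_segment ℝ a b) (right_mem_segment ℝ a b)
    (left_mem_segment ℝ a b), edgeClass_self h (hab (left_mem_segment ℝ a b))]

end EdgeClass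

/-! ### Continuous logarithms on compact sets -/

/-- A point of the unbounded part of the complement of a compact set `K` admits a continuous
logarithm of `x - z` on `K`. -/
theorem exists_continuousOn_log_sub {K : Set ℂ} (hK : IsCompact K) {z : ℂ}
    (hz : ¬ Bornology.IsBounded (connectedComponentIn Kᶜ z)) :
    ∃ f : ℂ → ℂ, ContinuousOn f K ∧ ∀ x ∈ K, Complex.exp (f x) = x - z := by
  have hzK : z ∈ Kᶜ := by
    by_contra h
    exact hz (by rw [connectedComponentIn_eq_empty h]; exact Bornology.isBounded_empty)
  -- `A` is relatively open and closed in `Kᶜ` and contains all points of large modulus, so it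
  -- contains every unbounded component.
  set A : Set ℂ := {w | ∃ f : ℂ → ℂ, ContinuousOn f K ∧ ∀ x ∈ K, Complex.exp (f x) = x - w}
  -- nearby points are alike
  have near : ∀ w w' : ℂ, (∀ x ∈ K, ‖w - w'‖ < ‖x - w‖) → w ∈ A → w' ∈ A := by
    rintro w w' hww' ⟨f, hf, hfe⟩
    have hne : ∀ x ∈ K, x - w ≠ 0 := fun x hx h => by
      have := hww' x hx
      rw [h, norm_zero] at this
      exact absurd this (not_lt.mpr (norm_nonneg _))
    -- This rests on `x - w' = (x - w) * (1 + (w - w') / (x - w))`, whose last factor is within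
    -- distance less than `1` of `1`.
    refine ⟨fun x => f x + Complex.log (1 + (w - w') / (x - w)), hf.add ?_, fun x hx => ?_⟩
    · refine ContinuousOn.clog ?_ fun x hx => ?_
      · exact continuousOn_const.add (continuousOn_const.div (by fun_prop) hne)
      · refine Complex.mem_slitPlane_of_norm_lt_one ?_
        rw [norm_div, div_lt_one (norm_pos_iff.mpr (hne x hx))]
        exact hww' x hx
    · have h1 : 1 + (w - w') / (x - w) ≠ 0 := by
        refine Complex.slitPlane_ne_zero (Complex.mem_slitPlane_of_norm_lt_one ?_)
        rw [norm_div, div_lt_one (norm_pos_iff.mpr (hne x hx))]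
        exact hww' x hx
      rw [Complex.exp_add, hfe x hx, Complex.exp_log h1]
      field_simp [hne x hx]
      ring
  have ball : ∀ w ∈ Kᶜ, ∃ r > 0, ∀ w' ∈ Metric.ball w r, w' ∈ Kᶜ ∧ (w ∈ A ↔ w' ∈ A) := by
    intro w hw
    obtain ⟨r, hr, hrK⟩ := Metric.isOpen_iff.mp hK.isClosed.isOpen_compl w hw
    refine ⟨r / 2, by positivity, fun w' hw' => ⟨hrK (Metric.ball_subset_ball (by linarith) hw'),
      near w w' fun x hx => ?_, near w' w fun x hx => ?_⟩⟩
    all_goals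
      have h1 : r ≤ ‖x - w‖ := by
        by_contra h
        exact hrK (show x ∈ Metric.ball w r by rw [Metric.mem_ball, dist_eq_norm]; linarith) hx
      rw [Metric.mem_ball, dist_eq_norm] at hw'
      have h2 : ‖w - w'‖ = ‖w' - w‖ := norm_sub_rev _ _
    · linarith
    · have h3 : ‖x - w‖ ≤ ‖x - w'‖ + ‖w' - w‖ := by
        simpa using norm_add_le (x - w') (w' - w)
      linarith
  obtain ⟨R, hR⟩ := hK.isBounded.subset_closedBall 0
  obtain ⟨w, hwC, hwR⟩ : ∃ w ∈ connectedComponentIn Kᶜ z, |R| < ‖w‖ := by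
    by_contra! h
    exact hz ((Metric.isBounded_closedBall (x := (0 : ℂ)) (r := |R|)).subset fun w hw => by
      simpa using h w hw)
  have hwA : w ∈ A := by
    have hw0 : w ≠ 0 := norm_pos_iff.mp ((abs_nonneg R).trans_lt hwR)
    have hsl : ∀ x ∈ K, 1 + -(x / w) ∈ Complex.slitPlane := fun x hx => by
      refine Complex.mem_slitPlane_of_norm_lt_one ?_
      rw [norm_neg, norm_div, div_lt_one (norm_pos_iff.mpr hw0)]
      have := hR hx
      simp only [Metric.mem_closedBall, dist_zero_right] at this
      exact (this.trans (le_abs_self R)).trans_lt hwR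
    refine ⟨fun x => Complex.log (-w) + Complex.log (1 + -(x / w)),
      continuousOn_const.add (ContinuousOn.clog (by fun_prop) hsl), fun x hx => ?_⟩
    rw [Complex.exp_add, Complex.exp_log (neg_ne_zero.mpr hw0),
      Complex.exp_log (Complex.slitPlane_ne_zero (hsl x hx))]
    field_simp
    ring
  have hsub : connectedComponentIn Kᶜ z ⊆ Kᶜ ∩ A := by
    refine isPreconnected_connectedComponentIn.subset_left_of_subset_union
      (v := Kᶜ \ A) ?_ ?_ ?_ ?_ ?_
    · refine Metric.isOpen_iff.mpr fun w hw => ?_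
      obtain ⟨r, hr, h⟩ := ball w hw.1
      exact ⟨r, hr, fun w' hw' => ⟨(h w' hw').1, (h w' hw').2.mp hw.2⟩⟩
    · refine Metric.isOpen_iff.mpr fun w hw => ?_
      obtain ⟨r, hr, h⟩ := ball w hw.1
      exact ⟨r, hr, fun w' hw' => ⟨(h w' hw').1, fun h' => hw.2 ((h w' hw').2.mpr h')⟩⟩
    · exact Set.disjoint_left.mpr fun x hx hx' => hx'.2 hx.2
    · intro x hx
      have := connectedComponentIn_subset _ _ hx
      by_cases hxA : x ∈ A
      · exact Or.inl ⟨this, hxA⟩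
      · exact Or.inr ⟨this, hxA⟩
    · exact ⟨w, hwC, connectedComponentIn_subset _ _ hwC, hwA⟩
  exact (hsub (mem_connectedComponentIn hzK)).2

/-- Two logarithms of `c` differ by an element of `2πiℤ`, and a continuous function from a
preconnected set to a discrete set is constant. -/
theorem im_eq_of_exp_eq_const {S : Set ℂ} (hS : IsPreconnected S) {g : ℂ → ℂ}
    (hg : ContinuousOn g S) {c : ℂ} (hc : ∀ x ∈ S, Complex.exp (g x) = c) {x y : ℂ}
    (hx : x ∈ S) (hy : y ∈ S) : (g x).im = (g y).im := by
  have h1 : ContinuousOn (fun z => ((g z).im - (g y).im) / (2 * Real.pi)) S :=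
    ((Complex.continuous_im.comp_continuousOn hg).sub continuousOn_const).div_const _
  have h2 : Set.MapsTo (fun z => ((g z).im - (g y).im) / (2 * Real.pi)) S
      (Set.range ((↑) : ℤ → ℝ)) := by
    intro z hz
    obtain ⟨n, hn⟩ := Complex.exp_eq_exp_iff_exists_int.mp ((hc z hz).trans (hc y hy).symm)
    refine ⟨n, ?_⟩
    have : (g z).im = (g y).im + n * (2 * Real.pi) := by simpa using congrArg Complex.im hn
    have := Real.pi_pos
    rw [eq_div_iff (by positivity)]
    linarith
  have : DiscreteTopology (Set.range ((↑) : ℤ → ℝ)) :=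
    Int.isClosedEmbedding_coe_real.isEmbedding.toHomeomorph.symm.isEmbedding.discreteTopology
  have h3 := hS.constant_of_mapsTo (T := Set.range ((↑) : ℤ → ℝ)) ⟨this⟩ h1 h2 hx hy
  have := Real.pi_pos
  simp only [sub_self, zero_div] at h3
  have h4 := (div_eq_zero_iff.mp h3).resolve_right (by positivity)
  linarith

/-- A connected set that reaches `v` from the left and from below, and misses the ray from `w`
through `v`, does not carry a logarithm of `x - w` that is continuous at `v`. -/
theorem false_of_log_across_ray {S : Set ℂ} (hS : IsPreconnected S) {f : ℂ → ℂ} {v w : ℂ}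
    (hf : ContinuousOn f (insert v S)) (hfe : ∀ x ∈ S, Complex.exp (f x) = x - w)
    (hre : w.re < v.re) (him : w.im < v.im)
    (hray : ∀ r : ℝ, 0 ≤ r → w + r * (v - w) ∉ S) {h : ℝ} (hh : 0 < h)
    (hleft : ∀ t : ℝ, 0 < t → t ≤ h → v - t ∈ S)
    (hbelow : ∀ t : ℝ, 0 < t → t ≤ h → v - t * Complex.I ∈ S) : False := by
  set u : ℂ := v - w with hu
  have hure : 0 < u.re := by simp [hu, hre]
  have huim : 0 < u.im := by simp [hu, him]
  have hu0 : u ≠ 0 := fun h => by simp [h] at hure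
  -- The principal branch in the coordinate `-(x - w) / u` is cut exactly along the ray, so on `S`
  -- its argument differs from `(f x).im` by a constant. At `v` the function `f` is continuous, but
  -- the argument tends to `-π` from the left and to `π` from below.
  have hslit : ∀ x ∈ S, -(x - w) / u ∈ Complex.slitPlane := by
    intro x hx
    by_contra hcon
    rw [Complex.mem_slitPlane_iff_not_le_zero, not_not, Complex.le_def] at hcon
    refine hray (-(-(x - w) / u).re) (by simpa using hcon.1) ?_
    have h1 : (((-(x - w) / u).re : ℝ) : ℂ) = -(x - w) / u :=
      Complex.ext (by simp) (by simpa using hcon.2.symm)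
    rw [Complex.ofReal_neg, h1]
    convert hx using 1
    field_simp
    ring
  have hcont : ContinuousOn (fun x => f x - Complex.log (-(x - w) / u)) S :=
    (hf.mono (Set.subset_insert _ _)).sub (ContinuousOn.clog (by fun_prop) hslit)
  have hconst : ∀ x ∈ S, Complex.exp (f x - Complex.log (-(x - w) / u)) = -u := by
    intro x hx
    have h1 := Complex.slitPlane_ne_zero (hslit x hx)
    rw [Complex.exp_sub, hfe x hx, Complex.exp_log h1]
    have h2 : x - w ≠ 0 := fun h => h1 (by simp [h])
    field_simp
  have him_eq : ∀ x ∈ S, ∀ y ∈ S,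
      (f x).im - (-(x - w) / u).arg = (f y).im - (-(y - w) / u).arg := by
    intro x hx y hy
    have := im_eq_of_exp_eq_const hS hcont hconst hx hy
    rwa [Complex.sub_im, Complex.sub_im, Complex.log_im, Complex.log_im] at this
  have hIoc : Set.Ioc 0 h ∈ 𝓝[>] (0 : ℝ) := Ioc_mem_nhdsGT hh
  have limf : ∀ d : ℂ, (∀ t : ℝ, 0 < t → t ≤ h → v - t * d ∈ S) →
      Tendsto (fun t : ℝ => (f (v - t * d)).im) (𝓝[>] 0) (𝓝 (f v).im) := by
    intro d hd
    have h1 := (Complex.continuous_im.continuousAt.tendsto.comp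
      (hf v (Set.mem_insert _ _)).tendsto)
    refine h1.comp (tendsto_nhdsWithin_iff.mpr ⟨?_, ?_⟩)
    · have : Continuous fun t : ℝ => v - t * d := by fun_prop
      simpa using (this.tendsto 0).mono_left nhdsWithin_le_nhds
    · filter_upwards [hIoc] with t ht using Set.mem_insert_of_mem _ (hd t ht.1 ht.2)
  have lim1 : ∀ d : ℂ, Tendsto (fun t : ℝ => -(v - t * d - w) / u) (𝓝[>] 0) (𝓝 (-1)) := by
    intro d
    have : Continuous fun t : ℝ => -(v - t * d - w) / u := by fun_prop
    have h2 : -(v - w) / u = -1 := by rw [← hu]; field_simp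
    have h3 := (this.tendsto 0).mono_left (nhdsWithin_le_nhds (s := Set.Ioi 0))
    simp only [Complex.ofReal_zero, zero_mul, sub_zero, h2] at h3
    exact h3
  have him1 : ∀ (d : ℂ) (t : ℝ), (-(v - t * d - w) / u).im = t * (d / u).im := by
    intro d t
    have : -(v - t * d - w) / u = -1 + t * (d / u) := by
      rw [show v - t * d - w = u - t * d by rw [hu]; ring]; field_simp; ring
    rw [this]; simp
  have hn : 0 < Complex.normSq u := Complex.normSq_pos.mpr hu0
  have argL : Tendsto (fun t : ℝ => (-(v - t * (1 : ℂ) - w) / u).arg) (𝓝[>] 0) (𝓝 (-Real.pi)) := by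
    refine (Complex.tendsto_arg_nhdsWithin_im_neg_of_re_neg_of_im_zero (z := -1)
      (by simp) (by simp)).comp (tendsto_nhdsWithin_iff.mpr ⟨lim1 1, ?_⟩)
    filter_upwards [self_mem_nhdsWithin] with t ht
    rw [him1]
    refine mul_neg_of_pos_of_neg ht ?_
    rw [one_div, Complex.inv_im]
    exact div_neg_of_neg_of_pos (by linarith) hn
  have argB : Tendsto (fun t : ℝ => (-(v - t * Complex.I - w) / u).arg) (𝓝[>] 0)
      (𝓝 Real.pi) := by
    have h0 := (Complex.continuousWithinAt_arg_of_re_neg_of_im_zero (z := -1)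
      (by simp) (by simp)).tendsto
    simp only [Complex.arg_neg_one] at h0
    refine h0.comp (tendsto_nhdsWithin_iff.mpr ⟨lim1 Complex.I, ?_⟩)
    filter_upwards [self_mem_nhdsWithin] with t ht
    rw [him1]
    refine (mul_pos ht ?_).le
    simp [Complex.div_im]
    positivity
  have hleft' : ∀ t : ℝ, 0 < t → t ≤ h → v - t * (1 : ℂ) ∈ S := by simpa using hleft
  have e := tendsto_nhds_unique_of_eventuallyEq ((limf 1 hleft').sub argL)
    ((limf Complex.I hbelow).sub argB) (by
      filter_upwards [hIoc] with t ht
      exact him_eq _ (hleft' t ht.1 ht.2) _ (hbelow t ht.1 ht.2))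
  have := Real.pi_pos
  linarith

/-! ### Lattice walks in the plane and the squares they enclose -/

/-- The point of the square lattice of mesh `h` with given coordinates. -/
def gridPoint (h : ℝ) (v : ℤ × ℤ) : ℂ := ⟨h * v.1, h * v.2⟩

/-- The union of the straight edges of a walk. -/
def walkSet {V : Type*} (P : V → ℂ) : List V → Set ℂ
  | a :: b :: l => segment ℝ (P a) (P b) ∪ walkSet P (b :: l)
  | [a] => {P a}
  | [] => ∅

section WalkSet

variable {V : Type*} {P : V → ℂ}

theorem mem_walkSet {l : List V} {u : V} (hu : u ∈ l) : P u ∈ walkSet P l := by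
  induction l with
  | nil => simp at hu
  | cons a l ih =>
    cases l with
    | nil => simp at hu; simp [walkSet, hu]
    | cons b l =>
      rcases List.mem_cons.mp hu with rfl | hu
      · exact Or.inl (left_mem_segment ℝ _ _)
      · exact Or.inr (ih hu)

theorem isCompact_segment (z w : ℂ) : IsCompact (segment ℝ z w) := by
  rw [← Path.range_segment]; exact isCompact_range (Path.continuous _)

theorem isCompact_walkSet (l : List V) : IsCompact (walkSet P l) := by
  induction l with
  | nil => exact isCompact_empty
  | cons a l ih =>
    cases l with
    | nil => exact isCompact_singleton
    | cons b l => exact (isCompact_segment _ _).union ih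

theorem isPreconnected_walkSet (l : List V) : IsPreconnected (walkSet P l) := by
  induction l with
  | nil => exact isPreconnected_empty
  | cons a l ih =>
    cases l with
    | nil => exact isPreconnected_singleton
    | cons b l =>
      exact IsPreconnected.union (P b) (right_mem_segment ℝ _ _) (mem_walkSet (by simp))
        (convex_segment _ _).isPreconnected ih

theorem exists_segment_of_mem_walkSet {E : V → V → Prop} {l : List V} (hl : List.IsChain E l)
    {z : ℂ} (hz : z ∈ walkSet P l) :
    (∃ a ∈ l, z = P a) ∨ ∃ a ∈ l, ∃ b ∈ l, E a b ∧ z ∈ segment ℝ (P a) (P b) := by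
  induction l with
  | nil => exact absurd hz (Set.notMem_empty z)
  | cons a l ih =>
    cases l with
    | nil => exact Or.inl ⟨a, by simp, hz⟩
    | cons b l =>
      rw [List.isChain_cons_cons] at hl
      rcases hz with hz | hz
      · exact Or.inr ⟨a, by simp, b, by simp, hl.1, hz⟩
      · rcases ih hl.2 hz with ⟨c, hc, h⟩ | ⟨c, hc, d, hd, h⟩
        · exact Or.inl ⟨c, List.mem_cons_of_mem _ hc, h⟩
        · exact Or.inr ⟨c, List.mem_cons_of_mem _ hc, d, List.mem_cons_of_mem _ hd, h⟩

end WalkSet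

theorem mem_segment_of_im_eq {a b z : ℂ} (ha : a.im = z.im) (hb : b.im = z.im)
    (h1 : a.re ≤ z.re) (h2 : z.re ≤ b.re) : z ∈ segment ℝ a b := by
  have : z.re ∈ segment ℝ a.re b.re := by
    rw [segment_eq_Icc (h1.trans h2)]; exact ⟨h1, h2⟩
  obtain ⟨s, t, hs, ht, hst, e⟩ := this
  refine ⟨s, t, hs, ht, hst, Complex.ext (by simpa using e) ?_⟩
  simp [ha, hb, ← add_mul, hst]

theorem mem_segment_of_re_eq {a b z : ℂ} (ha : a.re = z.re) (hb : b.re = z.re)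
    (h1 : a.im ≤ z.im) (h2 : z.im ≤ b.im) : z ∈ segment ℝ a b := by
  have : z.im ∈ segment ℝ a.im b.im := by
    rw [segment_eq_Icc (h1.trans h2)]; exact ⟨h1, h2⟩
  obtain ⟨s, t, hs, ht, hst, e⟩ := this
  refine ⟨s, t, hs, ht, hst, Complex.ext ?_ (by simpa using e)⟩
  simp [ha, hb, ← add_mul, hst]

/-- A lattice edge below `v` avoids the quadrant above `v` and the open square below `v`. -/
theorem gridEdge_avoids {h : ℝ} (hh : 0 < h) {a b v : ℤ × ℤ} (ha : LexBelow a v)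
    (hb : LexBelow b v) (hab : LatticeAdj a b) {z : ℂ}
    (hz : z ∈ segment ℝ (gridPoint h a) (gridPoint h b)) :
    ¬ (h * v.1 ≤ z.re ∧ h * v.2 ≤ z.im) ∧
    ¬ (h * v.1 - h < z.re ∧ z.re < h * v.1 ∧ h * v.2 - h < z.im ∧ z.im < h * v.2) := by
  obtain ⟨s, t, hs, ht, hst, rfl⟩ := hz
  have hre : (s • gridPoint h a + t • gridPoint h b).re = h * (s * a.1 + t * b.1) := by
    simp [gridPoint]; ring
  have him : (s • gridPoint h a + t • gridPoint h b).im = h * (s * a.2 + t * b.2) := by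
    simp [gridPoint]; ring
  have hlt : ∀ x y m : ℤ, x < m → y < m → s * x + t * y < m := by
    intro x y m hx hy
    have hx' : (x : ℝ) + 1 ≤ m := by exact_mod_cast hx
    have hy' : (y : ℝ) + 1 ≤ m := by exact_mod_cast hy
    have h1 := mul_le_mul_of_nonneg_left hx' hs
    have h2 := mul_le_mul_of_nonneg_left hy' ht
    have h3 : s * (m : ℝ) + t * m = m := by rw [← add_mul, hst, one_mul]
    linarith
  -- Every lattice edge has one coordinate fixed at a multiple of `h`, and no multiple lies strictly
  -- between two consecutive ones.
  have hmid : ∀ x m : ℤ, ¬ (h * m - h < h * x ∧ h * x < h * m) := by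
    rintro x m ⟨h1, h2⟩
    have h3 : (x : ℝ) < m := lt_of_mul_lt_mul_left h2 hh.le
    have h4 : (m : ℝ) - 1 < x := lt_of_mul_lt_mul_left (by linarith) hh.le
    have h3' : x < m := by exact_mod_cast h3
    have h4' : m - 1 < x := by exact_mod_cast h4
    omega
  have hsame : ∀ x : ℤ, s * (x : ℝ) + t * x = x := fun x => by rw [← add_mul, hst, one_mul]
  rw [hre, him]
  rcases hab with ⟨e, -⟩ | ⟨e, -⟩
  · rw [← e, hsame]
    refine ⟨fun ⟨h1, h2⟩ => ?_, fun ⟨h1, h2, _⟩ => hmid _ _ ⟨h1, h2⟩⟩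
    have h3 : v.1 ≤ a.1 := by exact_mod_cast le_of_mul_le_mul_left h1 hh
    have h4 := le_of_mul_le_mul_left h2 hh
    have ha2 : a.2 < v.2 := by rcases ha with h | h <;> omega
    have hb2 : b.2 < v.2 := by rcases hb with h | h <;> omega
    exact absurd (hlt _ _ _ ha2 hb2) (not_lt.mpr h4)
  · rw [← e, hsame]
    refine ⟨fun ⟨h1, h2⟩ => ?_, fun ⟨_, _, h1, h2⟩ => hmid _ _ ⟨h1, h2⟩⟩
    have h3 : v.2 ≤ a.2 := by exact_mod_cast le_of_mul_le_mul_left h2 hh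
    have h4 := le_of_mul_le_mul_left h1 hh
    have ha2 : a.1 < v.1 := by rcases ha with h | h <;> omega
    have hb2 : b.1 < v.1 := by rcases hb with h | h <;> omega
    exact absurd (hlt _ _ _ ha2 hb2) (not_lt.mpr h4)

/-- The closed lattice square whose upper right corner is `v`. -/
def gridSquare (h : ℝ) (v : ℤ × ℤ) : Set ℂ :=
  {z | h * v.1 - h ≤ z.re ∧ z.re ≤ h * v.1 ∧ h * v.2 - h ≤ z.im ∧ z.im ≤ h * v.2}

theorem convex_gridSquare (h : ℝ) (v : ℤ × ℤ) : Convex ℝ (gridSquare h v) := by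
  have e : gridSquare h v = Complex.reLm ⁻¹' Set.Icc (h * v.1 - h) (h * v.1) ∩
      Complex.imLm ⁻¹' Set.Icc (h * v.2 - h) (h * v.2) := by
    ext z; simp [gridSquare, and_assoc]
  rw [e]
  exact ((convex_Icc _ _).linear_preimage _).inter ((convex_Icc _ _).linear_preimage _)

/-- `U` contains the bounded components of the complement of its compact connected subsets. -/
def FillsHoles (U : Set ℂ) : Prop :=
  ∀ K ⊆ U, IsCompact K → IsConnected K → ∀ z ∉ K,
    Bornology.IsBounded (connectedComponentIn Kᶜ z) → z ∈ U

/-- For a point `w` of the square outside `U`, the absence of holes gives a continuous logarithm of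
`x - w` on the continuum `γ` formed by the walk. The ray from `w` through the corner meets `γ` only
at that corner, which `false_of_log_across_ray` forbids. -/
theorem FillsHoles.gridSquare_subset {U : Set ℂ} (hU : FillsHoles U) {h : ℝ} (hh : 0 < h)
    {v : ℤ × ℤ} {s : List (ℤ × ℤ)}
    (hs : List.IsChain (fun a b => LatticeAdj a b ∧
      segment ℝ (gridPoint h a) (gridPoint h b) ⊆ U) (v :: s ++ [v]))
    (hlex : ∀ u ∈ s, LexBelow u v) (hL : (v.1 - 1, v.2) ∈ s) (hB : (v.1, v.2 - 1) ∈ s)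
    (hLU : segment ℝ (gridPoint h (v.1 - 1, v.2)) (gridPoint h v) ⊆ U)
    (hBU : segment ℝ (gridPoint h v) (gridPoint h (v.1, v.2 - 1)) ⊆ U) :
    gridSquare h v ⊆ U := by
  set P := gridPoint h
  have hs' : List.IsChain (fun a b => LatticeAdj a b ∧ segment ℝ (P a) (P b) ⊆ U) s :=
    hs.infix ⟨[v], [v], by simp⟩
  have hLre : (P (v.1 - 1, v.2)).re = h * v.1 - h := by simp [P, gridPoint]; ring
  have hLim : (P (v.1 - 1, v.2)).im = h * v.2 := by simp [P, gridPoint]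
  have hBre : (P (v.1, v.2 - 1)).re = h * v.1 := by simp [P, gridPoint]
  have hBim : (P (v.1, v.2 - 1)).im = h * v.2 - h := by simp [P, gridPoint]; ring
  have hvre : (P v).re = h * v.1 := rfl
  have hvim : (P v).im = h * v.2 := rfl
  set γ : Set ℂ := walkSet P s ∪ (segment ℝ (P (v.1 - 1, v.2)) (P v) ∪
    segment ℝ (P v) (P (v.1, v.2 - 1))) with hγ
  have hγc : IsCompact γ := (isCompact_walkSet s).union
    ((isCompact_segment _ _).union (isCompact_segment _ _))
  have hγconn : IsConnected γ := by
    refine ⟨⟨P v, Or.inr (Or.inl (right_mem_segment ℝ _ _))⟩, ?_⟩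
    refine IsPreconnected.union (P (v.1 - 1, v.2)) (mem_walkSet hL)
      (Or.inl (left_mem_segment ℝ _ _)) (isPreconnected_walkSet s) ?_
    exact IsPreconnected.union (P v) (right_mem_segment ℝ _ _) (left_mem_segment ℝ _ _)
      (convex_segment _ _).isPreconnected (convex_segment _ _).isPreconnected
  have avoid : ∀ z ∈ walkSet P s, ¬ (h * v.1 ≤ z.re ∧ h * v.2 ≤ z.im) ∧
      ¬ (h * v.1 - h < z.re ∧ z.re < h * v.1 ∧ h * v.2 - h < z.im ∧ z.im < h * v.2) := by
    intro z hz
    rcases exists_segment_of_mem_walkSet hs' hz with ⟨a, ha, rfl⟩ | ⟨a, ha, b, hb, hab, hz⟩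
    · exact gridEdge_avoids hh (hlex a ha) (hlex a ha) (Or.inl ⟨rfl, by simp⟩)
        (left_mem_segment ℝ _ _)
    · exact gridEdge_avoids hh (hlex a ha) (hlex b hb) hab.1 hz
  have hγU : γ ⊆ U := by
    refine Set.union_subset (fun z hz => ?_) (Set.union_subset hLU hBU)
    rcases exists_segment_of_mem_walkSet hs' hz with ⟨a, ha, rfl⟩ | ⟨a, ha, b, hb, hab, hz⟩
    -- `s` may be a single vertex as far as `walkSet` is concerned; the edge of the closed walk that
    -- leaves `a` puts it in `U`.
    · obtain ⟨l₁, l₂, rfl⟩ := List.append_of_mem ha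
      have e : v :: (l₁ ++ a :: l₂) ++ [v] = (v :: l₁) ++ a :: (l₂ ++ [v]) := by simp
      have h2 := (List.isChain_split.mp (e ▸ hs)).2
      obtain ⟨b, l, hl⟩ := List.exists_cons_of_ne_nil
        (List.append_ne_nil_of_right_ne_nil l₂ (List.cons_ne_nil v []))
      rw [hl, List.isChain_cons_cons] at h2
      exact h2.1.2 (left_mem_segment ℝ _ _)
    · exact hab.2 hz
  intro w hw
  by_contra hwU
  have hwγ : w ∉ γ := fun h => hwU (hγU h)
  obtain ⟨f, hf, hfe⟩ := exists_continuousOn_log_sub hγc fun hb =>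
    hwU (hU γ hγU hγc hγconn w hwγ hb)
  obtain ⟨hw1, hw2, hw3, hw4⟩ := hw
  have hw2' : w.re < h * v.1 := by
    refine lt_of_le_of_ne hw2 fun e => hwγ (Or.inr (Or.inr ?_))
    rw [segment_symm]
    exact mem_segment_of_re_eq (by rw [hBre, e]) (by rw [hvre, e]) (by rw [hBim]; exact hw3)
      (by rw [hvim]; exact hw4)
  have hw4' : w.im < h * v.2 := by
    refine lt_of_le_of_ne hw4 fun e => hwγ (Or.inr (Or.inl ?_))
    exact mem_segment_of_im_eq (by rw [hLim, e]) (by rw [hvim, e]) (by rw [hLre]; exact hw1)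
      (by rw [hvre]; exact hw2)
  -- This is `γ` without the corner `P v`. It stays connected because `s`, which avoids `v`,
  -- contains the other ends of both edges.
  set S : Set ℂ := walkSet P s ∪ ((fun t : ℝ => P v - t) '' Set.Ioc 0 h ∪
    (fun t : ℝ => P v - t * Complex.I) '' Set.Ioc 0 h) with hS
  have hLS : P v - h = P (v.1 - 1, v.2) :=
    Complex.ext (by simp [hLre, hvre]) (by simp [hLim, hvim])
  have hBS : P v - h * Complex.I = P (v.1, v.2 - 1) :=
    Complex.ext (by simp [hBre, hvre]) (by simp [hBim, hvim])
  have hSconn : IsPreconnected S := by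
    rw [hS, ← Set.union_assoc]
    refine IsPreconnected.union (P (v.1, v.2 - 1)) (Or.inl (mem_walkSet hB))
      ⟨h, ⟨hh, le_rfl⟩, hBS⟩ ?_
      (isPreconnected_Ioc.image _ (Continuous.continuousOn (by fun_prop)))
    exact IsPreconnected.union (P (v.1 - 1, v.2)) (mem_walkSet hL)
      ⟨h, ⟨hh, le_rfl⟩, hLS⟩ (isPreconnected_walkSet s)
      (isPreconnected_Ioc.image _ (Continuous.continuousOn (by fun_prop)))
  have hSγ : S ⊆ γ := by
    refine Set.union_subset_union_right _ (Set.union_subset_union ?_ ?_)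
    · rintro _ ⟨t, ht, rfl⟩
      refine mem_segment_of_im_eq ?_ ?_ ?_ ?_ <;> simp [hLre, hLim, hvre, hvim] <;>
        linarith [ht.1, ht.2]
    · rintro _ ⟨t, ht, rfl⟩
      rw [segment_symm]
      refine mem_segment_of_re_eq ?_ ?_ ?_ ?_ <;> simp [hBre, hBim, hvre, hvim] <;>
        linarith [ht.1, ht.2]
  have hvγ : P v ∈ γ := Or.inr (Or.inl (right_mem_segment ℝ _ _))
  refine false_of_log_across_ray hSconn (v := P v) (w := w)
    (hf.mono (Set.insert_subset hvγ hSγ)) (fun x hx => hfe x (hSγ hx)) hw2' hw4' ?_ hh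
    (fun t h0 h1 => Or.inr (Or.inl ⟨t, ⟨h0, h1⟩, rfl⟩))
    (fun t h0 h1 => Or.inr (Or.inr ⟨t, ⟨h0, h1⟩, rfl⟩))
  -- The ray is at `w ∉ γ` for `r = 0`, in the open square for `0 < r < 1`, and in the closed
  -- quadrant above `v` for `1 ≤ r`. It meets the lines of the two edges only at `r = 1`, that is at
  -- `P v`.
  intro r hr hmem
  have hzre : (w + r * (P v - w)).re = w.re + r * (h * v.1 - w.re) := by simp [hvre]
  have hzim : (w + r * (P v - w)).im = w.im + r * (h * v.2 - w.im) := by simp [hvim]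
  rcases hmem with hz | ⟨t, ht, e⟩ | ⟨t, ht, e⟩
  · have := avoid _ hz
    rw [hzre, hzim] at this
    rcases hr.eq_or_lt with rfl | hr0
    · exact hwγ (Or.inl (by simpa using hz))
    rcases lt_or_ge r 1 with hr1 | hr1
    · refine this.2 ⟨?_, ?_, ?_, ?_⟩ <;> nlinarith
    · refine this.1 ⟨?_, ?_⟩ <;> nlinarith
  · have e1 := congrArg Complex.re e
    have e2 := congrArg Complex.im e
    simp only [hzre, hzim] at e1 e2
    simp [hvre, hvim] at e1 e2
    have h3 : (r - 1) * (h * v.2 - w.im) = 0 := by linarith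
    have h4 : r = 1 := by
      rcases mul_eq_zero.mp h3 with h5 | h5 <;> linarith
    subst h4
    linarith [ht.1]
  · have e1 := congrArg Complex.re e
    have e2 := congrArg Complex.im e
    simp only [hzre, hzim] at e1 e2
    simp [hvre, hvim] at e1 e2
    have h3 : (r - 1) * (h * v.1 - w.re) = 0 := by linarith
    have h4 : r = 1 := by
      rcases mul_eq_zero.mp h3 with h5 | h5 <;> linarith
    subst h4
    linarith [ht.1]

theorem pathClass_cast {X : Type*} [TopologicalSpace X] {x₀ : X} (h : ∀ z : X, Path x₀ z)
    {a b a' b' : X} (p : Path a b) (ha : a' = a) (hb : b' = b) :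
    pathClass h (p.cast ha hb) = pathClass h p := by
  subst ha hb; rfl

theorem exists_lattice_lower_bound (l : List (ℤ × ℤ)) :
    ∃ o : ℤ × ℤ, ∀ u ∈ l, o.1 ≤ u.1 ∧ o.2 ≤ u.2 := by
  induction l with
  | nil => exact ⟨0, by simp⟩
  | cons a l ih =>
    obtain ⟨o, ho⟩ := ih
    refine ⟨(min a.1 o.1, min a.2 o.2), fun u hu => ?_⟩
    rcases List.mem_cons.mp hu with rfl | hu
    · exact ⟨min_le_left _ _, min_le_left _ _⟩
    · exact ⟨(min_le_right _ _).trans (ho u hu).1, (min_le_right _ _).trans (ho u hu).2⟩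

/-- In a set without holes, the edge classes along closed lattice walks multiply to `1`. -/
theorem FillsHoles.walkProd_edgeClass {U : Set ℂ} (hU : FillsHoles U) {x₀ : U}
    (H : ∀ z : U, Path x₀ z) {h : ℝ} (hh : 0 < h) (a : ℤ × ℤ) (s : List (ℤ × ℤ))
    (hs : List.IsChain (fun a b => LatticeAdj a b ∧
      segment ℝ (gridPoint h a) (gridPoint h b) ⊆ U) (a :: s ++ [a])) :
    walkProd (fun a b => edgeClass H (gridPoint h a) (gridPoint h b)) (a :: s ++ [a]) = 1 := by
  obtain ⟨o, ho⟩ := exists_lattice_lower_bound (a :: s)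
  refine walkProd_closed_eq_one (E := fun a b => LatticeAdj a b ∧
      segment ℝ (gridPoint h a) (gridPoint h b) ⊆ U) (fun a b h => h.1)
    (fun a h => edgeClass_self H (h.2 (left_mem_segment ℝ _ _)))
    (fun a b h => edgeClass_mul_symm H h.2) ?_ ?_ o a s ho hs
  · intro v t ht hlex hL hB hLv hvB
    have hsq := hU.gridSquare_subset hh ht hlex hL hB hLv.2 hvB.2
    have hc := convex_gridSquare h v
    have m1 : gridPoint h v ∈ gridSquare h v := by
      refine ⟨?_, ?_, ?_, ?_⟩ <;> simp [gridPoint] <;> linarith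
    have m2 : gridPoint h (v.1 - 1, v.2) ∈ gridSquare h v := by
      refine ⟨?_, ?_, ?_, ?_⟩ <;> simp [gridPoint] <;> linarith
    have m3 : gridPoint h (v.1, v.2 - 1) ∈ gridSquare h v := by
      refine ⟨?_, ?_, ?_, ?_⟩ <;> simp [gridPoint] <;> linarith
    have m4 : gridPoint h (v.1 - 1, v.2 - 1) ∈ gridSquare h v := by
      refine ⟨?_, ?_, ?_, ?_⟩ <;> simp [gridPoint] <;> linarith
    refine ⟨⟨Or.inl ⟨rfl, by simp⟩, (hc.segment_subset m2 m4).trans hsq⟩,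
      ⟨Or.inr ⟨rfl, by simp⟩, (hc.segment_subset m4 m3).trans hsq⟩, ?_⟩
    rw [edgeClass_mul H hc hsq m2 m1 m3, edgeClass_mul H hc hsq m2 m4 m3]
  · rintro a b ⟨h1, h2⟩
    refine ⟨?_, by rwa [segment_symm]⟩
    rcases h1 with ⟨e, h⟩ | ⟨e, h⟩
    · exact Or.inl ⟨e.symm, by rwa [abs_sub_comm]⟩
    · exact Or.inr ⟨e.symm, by rwa [abs_sub_comm]⟩

/-! ### From loops to lattice walks -/

/-- The lattice point below and to the left of a complex number. -/
noncomputable def gridFloor (h : ℝ) (z : ℂ) : ℤ × ℤ := (⌊z.re / h⌋, ⌊z.im / h⌋)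

theorem abs_mul_floor_sub_lt {h : ℝ} (hh : 0 < h) (x : ℝ) : |h * ⌊x / h⌋ - x| < h := by
  have h1 := Int.floor_le (x / h)
  have h2 := Int.lt_floor_add_one (x / h)
  rw [le_div_iff₀ hh] at h1
  rw [div_lt_iff₀ hh] at h2
  rw [abs_lt]
  constructor <;> linarith

theorem abs_floor_sub_le_one {h : ℝ} (hh : 0 < h) {x y : ℝ} (hxy : |x - y| < h) :
    |⌊x / h⌋ - ⌊y / h⌋| ≤ 1 := by
  have e : |x / h - y / h| < 1 := by
    rw [← sub_div, abs_div, abs_of_pos hh, div_lt_one hh]; exact hxy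
  rw [abs_lt] at e
  have h1 := Int.floor_le (x / h)
  have h2 := Int.lt_floor_add_one (x / h)
  have h3 := Int.floor_le (y / h)
  have h4 := Int.lt_floor_add_one (y / h)
  have h5 : (⌊x / h⌋ : ℝ) < ⌊y / h⌋ + 2 := by linarith
  have h6 : (⌊y / h⌋ : ℝ) < ⌊x / h⌋ + 2 := by linarith
  have h5' : ⌊x / h⌋ < ⌊y / h⌋ + 2 := by exact_mod_cast h5
  have h6' : ⌊y / h⌋ < ⌊x / h⌋ + 2 := by exact_mod_cast h6
  rw [abs_le]; omega

/-- The lattice walk that follows a path through prescribed closely spaced points. -/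
theorem exists_lattice_walk {U : Set ℂ} {x₀ : U} (H : ∀ z : U, Path x₀ z) {h : ℝ} (hh : 0 < h)
    {x : U} (γ : Path x x) (hball : ∀ t, Metric.ball (γ t : ℂ) (4 * h) ⊆ U)
    (t : ℕ → unitInterval) (ht : Monotone t) (ht0 : t 0 = 0)
    (hclose : ∀ k, ∀ s ∈ Set.Icc (t k) (t (k + 1)), dist (γ s : ℂ) (γ (t k)) < h) (k : ℕ) :
    ∃ l : List (ℤ × ℤ),
      List.IsChain (fun a b => LatticeAdj a b ∧
        segment ℝ (gridPoint h a) (gridPoint h b) ⊆ U) (l ++ [gridFloor h (γ (t k))]) ∧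
      (∃ r, l ++ [gridFloor h (γ (t k))] = gridFloor h (γ 0) :: r) ∧
      walkProd (fun a b => edgeClass H (gridPoint h a) (gridPoint h b))
          (l ++ [gridFloor h (γ (t k))]) =
        edgeClass H (gridPoint h (gridFloor h (γ 0))) (γ 0) * pathClass H (γ.subpath 0 (t k)) *
          edgeClass H (γ (t k)) (gridPoint h (gridFloor h (γ (t k)))) := by
  have hb : ∀ s, Convex ℝ (Metric.ball (γ s : ℂ) (4 * h)) := fun s => convex_ball _ _
  have hself : ∀ s, (γ s : ℂ) ∈ Metric.ball (γ s : ℂ) (4 * h) :=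
    fun s => Metric.mem_ball_self (by positivity)
  have hfl : ∀ z : ℂ, |(gridPoint h (gridFloor h z)).re - z.re| < h ∧
      |(gridPoint h (gridFloor h z)).im - z.im| < h := fun z =>
    ⟨abs_mul_floor_sub_lt hh z.re, abs_mul_floor_sub_lt hh z.im⟩
  -- The radius `4 * h` comes from here: the lattice points used near `z` are off by less than `2 *
  -- h` in each coordinate.
  have hmem : ∀ z w : ℂ, |w.re - z.re| < 2 * h → |w.im - z.im| < 2 * h →
      w ∈ Metric.ball z (4 * h) := by
    intro z w h1 h2
    rw [Metric.mem_ball, dist_eq_norm]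
    refine (Complex.norm_le_abs_re_add_abs_im _).trans_lt ?_
    rw [Complex.sub_re, Complex.sub_im]
    linarith
  induction k with
  | zero =>
    rw [ht0]
    refine ⟨[], by simp, ⟨[], rfl⟩, ?_⟩
    have h0 := hmem (γ 0) (gridPoint h (gridFloor h (γ 0)))
      ((hfl _).1.trans (by linarith)) ((hfl _).2.trans (by linarith))
    have e1 := pathClass_eq_edgeClass H (convex_singleton (γ 0 : ℂ)) (by simp)
      (γ.subpath 0 0) (by simp)
    rw [e1, edgeClass_mul H (hb 0) (hball 0) h0 (hself 0) (hself 0),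
      edgeClass_mul H (hb 0) (hball 0) h0 (hself 0) h0, edgeClass_self H (hball 0 h0)]
    rfl
  | succ k ih =>
    obtain ⟨l, hl1, ⟨r, hl2⟩, hl3⟩ := ih
    set z : ℂ := Subtype.val (γ (t k)) with hz
    set z' : ℂ := Subtype.val (γ (t (k + 1))) with hz'
    set g := gridFloor h z with hg
    set g' := gridFloor h z' with hg'
    have hzz' : ‖z' - z‖ < h := by
      rw [← dist_eq_norm]; exact hclose k _ ⟨ht (Nat.le_succ k), le_rfl⟩
    have hre : |z'.re - z.re| < h := (Complex.abs_re_le_norm (z' - z)).trans_lt hzz'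
    have him : |z'.im - z.im| < h := (Complex.abs_im_le_norm (z' - z)).trans_lt hzz'
    have mz := hself (t k)
    have mz' : z' ∈ Metric.ball z (4 * h) := hmem z z' (by linarith) (by linarith)
    have mg : gridPoint h g ∈ Metric.ball z (4 * h) :=
      hmem _ _ ((hfl z).1.trans (by linarith)) ((hfl z).2.trans (by linarith))
    have tri : ∀ a b c : ℝ, |a - b| < h → |b - c| < h → |a - c| < 2 * h := fun a b c h1 h2 =>
      (abs_sub_le a b c).trans_lt (by linarith)
    have mg' : gridPoint h g' ∈ Metric.ball z (4 * h) :=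
      hmem _ _ (tri _ _ _ (hfl z').1 hre) (tri _ _ _ (hfl z').2 him)
    have mm : gridPoint h (g'.1, g.2) ∈ Metric.ball z (4 * h) :=
      hmem _ _ (tri _ _ _ (hfl z').1 hre) ((hfl z).2.trans (by linarith))
    have hB := hball (t k)
    have hc := hb (t k)
    -- One horizontal and one vertical step, either possibly constant, lead from `g` to `g'` inside
    -- the ball around `z`.
    refine ⟨l ++ [g, (g'.1, g.2)], ?_, ?_, ?_⟩
    · have e : l ++ [g, (g'.1, g.2)] ++ [g'] = l ++ g :: [(g'.1, g.2), g'] := by simp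
      rw [e]
      refine List.isChain_split.mpr ⟨hl1, ?_⟩
      simp only [List.isChain_cons_cons, List.isChain_singleton, and_true]
      refine ⟨⟨Or.inr ⟨rfl, ?_⟩, (hc.segment_subset mg mm).trans hB⟩,
        ⟨Or.inl ⟨rfl, ?_⟩, (hc.segment_subset mm mg').trans hB⟩⟩
      · exact abs_floor_sub_le_one hh (by rwa [abs_sub_comm])
      · exact abs_floor_sub_le_one hh (by rwa [abs_sub_comm])
    · refine ⟨r ++ [(g'.1, g.2), g'], ?_⟩
      rw [← List.cons_append, ← hl2]; simp
    · have e : l ++ [g, (g'.1, g.2)] ++ [g'] = l ++ g :: [(g'.1, g.2), g'] := by simp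
      rw [e, walkProd_append_cons, hl3]
      have e1 : pathClass H (γ.subpath 0 (t (k + 1))) =
          pathClass H (γ.subpath 0 (t k)) * edgeClass H z z' := by
        rw [← pathClass_congr H ⟨Path.Homotopy.subpathTransSubpath γ 0 (t k) (t (k + 1))⟩,
          pathClass_trans]
        congr 1
        refine pathClass_eq_edgeClass H hc hB _ fun s => ?_
        have : γ.subpath (t k) (t (k + 1)) s ∈ Set.range (γ.subpath (t k) (t (k + 1))) := ⟨s, rfl⟩
        rw [Path.range_subpath_of_le _ _ _ (ht (Nat.le_succ k))] at this
        obtain ⟨u, hu, hu'⟩ := this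
        rw [← hu', Metric.mem_ball]
        exact (hclose k u hu).trans (by linarith)
      rw [e1]
      simp only [walkProd_cons_cons, walkProd_singleton, mul_one, mul_assoc]
      rw [edgeClass_mul H hc hB mg mm mg', edgeClass_mul H hc hB mz mg mg',
        edgeClass_mul H hc hB mz mz' mg']

/-- A plane domain that contains the bounded components of the complements of its continua is
simply connected. -/
theorem FillsHoles.isSimplyConnected {U : Set ℂ} (hU : FillsHoles U) (hUo : IsOpen U)
    (hUc : IsConnected U) : IsSimplyConnected U := by
  have hpc : PathConnectedSpace U :=
    isPathConnected_iff_pathConnectedSpace.mp (hUo.isConnected_iff_isPathConnected.mp hUc)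
  refine simply_connected_iff_loops_nullhomotopic.mpr ⟨hpc, fun x γ => ?_⟩
  let H : ∀ z : U, Path x z := fun z => PathConnectedSpace.somePath x z
  have hγ : Continuous fun t => (γ t : ℂ) := by fun_prop
  obtain ⟨ε, hε, hεU⟩ := (isCompact_range hγ).exists_thickening_subset_open hUo
    (by rintro _ ⟨t, rfl⟩; exact (γ t).2)
  set h : ℝ := ε / 4 with hh'
  have hh : 0 < h := by positivity
  have hball : ∀ t, Metric.ball (γ t : ℂ) (4 * h) ⊆ U := fun t => by
    refine subset_trans ?_ hεU
    rw [show 4 * h = ε by rw [hh']; ring]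
    exact Metric.ball_subset_thickening (E := Set.range fun t => (γ t : ℂ)) ⟨t, rfl⟩ ε
  -- Each piece of the loop fits in a ball of radius `h / 2`, so any two of its points are less than
  -- `h` apart.
  obtain ⟨t, ht0, htm, ⟨n, hn⟩, hcov⟩ := exists_monotone_Icc_subset_open_cover_unitInterval
    (c := fun z : ℂ => (fun t => (γ t : ℂ)) ⁻¹' Metric.ball z (h / 2))
    (fun z => Metric.isOpen_ball.preimage hγ)
    (fun s _ => Set.mem_iUnion.mpr ⟨γ s, Metric.mem_ball_self (by positivity)⟩)
  have hclose : ∀ k, ∀ s ∈ Set.Icc (t k) (t (k + 1)), dist (γ s : ℂ) (γ (t k)) < h := by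
    intro k s hs
    obtain ⟨z, hz⟩ := hcov k
    have h1 := hz hs
    have h2 := hz (Set.left_mem_Icc.mpr (htm (Nat.le_succ k)))
    simp only [Set.mem_preimage, Metric.mem_ball] at h1 h2
    rw [dist_comm] at h2
    exact (dist_triangle _ z _).trans_lt (by linarith)
  obtain ⟨l, hl1, ⟨r, hl2⟩, hl3⟩ := exists_lattice_walk H hh γ hball t htm ht0 hclose n
  have hn1 : t n = 1 := hn n le_rfl
  have e01 : γ (t n) = γ 0 := by rw [hn1, γ.source, γ.target]
  have hprod : walkProd (fun a b => edgeClass H (gridPoint h a) (gridPoint h b))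
      (l ++ [gridFloor h (γ (t n))]) = 1 := by
    rw [e01] at hl1 hl2 ⊢
    cases l with
    | nil => rfl
    | cons a l =>
      obtain rfl : a = gridFloor h (γ 0) := by simpa using (List.cons.inj hl2).1
      exact hU.walkProd_edgeClass H hh _ l hl1
  rw [hprod] at hl3
  have hcls : pathClass H (γ.subpath 0 (t n)) = pathClass H γ := by
    rw [hn1, Path.subpath_zero_one, pathClass_cast]
  rw [hcls, e01] at hl3
  refine homotopic_refl_of_pathClass_eq_one H ?_
  have m0 : (γ 0 : ℂ) ∈ Metric.ball (γ 0 : ℂ) (4 * h) := Metric.mem_ball_self (by positivity)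
  have mg : gridPoint h (gridFloor h (γ 0)) ∈ Metric.ball (γ 0 : ℂ) (4 * h) := by
    rw [Metric.mem_ball, dist_eq_norm]
    refine (Complex.norm_le_abs_re_add_abs_im _).trans_lt ?_
    have h1 := abs_mul_floor_sub_lt hh (γ 0 : ℂ).re
    have h2 := abs_mul_floor_sub_lt hh (γ 0 : ℂ).im
    simp only [Complex.sub_re, Complex.sub_im, gridPoint, gridFloor]
    linarith
  -- The link to the first lattice point and the link back are inverse, so `hl3` says that a
  -- conjugate of the class of the loop is `1`.
  have hinv := edgeClass_mul H (convex_ball _ _) (hball 0) mg m0 mg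
  rw [edgeClass_self H (hball 0 mg)] at hinv
  rw [eq_inv_of_mul_eq_one_right hinv, mul_assoc] at hl3
  exact conj_eq_one_iff.mp ((mul_assoc _ _ _).trans hl3.symm)

/-! ### Dynamics in the punctured plane -/

/-- The points of the plane whose orbit under `t` avoids `0` and converges to `ξ`. -/
def planeBasin (t : ℂ → ℂ) (ξ : ℂ) : Set ℂ :=
  {z | (∀ k : ℕ, t^[k] z ≠ 0) ∧ Tendsto (fun k : ℕ => t^[k] z) atTop (𝓝 ξ)}

/-- The component of a limit point outside `K` is open, so it meets, hence equals, the component of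
`z`. -/
theorem closure_connectedComponentIn_compl_subset {K : Set ℂ} (hK : IsClosed K) (z : ℂ) :
    closure (connectedComponentIn Kᶜ z) ⊆ connectedComponentIn Kᶜ z ∪ K := by
  intro x hx
  by_contra hcon
  rw [Set.mem_union, not_or] at hcon
  have ho : IsOpen (connectedComponentIn Kᶜ x) := hK.isOpen_compl.connectedComponentIn
  obtain ⟨y, hy1, hy2⟩ := mem_closure_iff.mp hx _ ho (mem_connectedComponentIn hcon.2)
  apply hcon.1
  rw [connectedComponentIn_eq hy2, ← connectedComponentIn_eq hy1]
  exact mem_connectedComponentIn hcon.2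

section Dynamics

variable {t : ℂ → ℂ} {ξ : ℂ}

theorem differentiableAt_iterate (ht : ∀ z ≠ 0, DifferentiableAt ℂ t z) {k : ℕ} {z : ℂ}
    (hz : ∀ j < k, t^[j] z ≠ 0) : DifferentiableAt ℂ t^[k] z := by
  induction k with
  | zero => exact differentiableAt_id
  | succ k ih =>
    rw [Function.iterate_succ']
    exact (ht _ (hz k (Nat.lt_succ_self k))).comp z
      (ih fun j hj => hz j (hj.trans (Nat.lt_succ_self k)))

theorem mem_planeBasin_of_iterate {k : ℕ} {z : ℂ} (hz : ∀ j < k, t^[j] z ≠ 0)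
    (hk : t^[k] z ∈ planeBasin t ξ) : z ∈ planeBasin t ξ := by
  refine ⟨fun j => ?_, ?_⟩
  · rcases lt_or_ge j k with h | h
    · exact hz j h
    · have := hk.1 (j - k)
      rwa [← Function.iterate_add_apply, Nat.sub_add_cancel h] at this
  · rw [← tendsto_add_atTop_iff_nat k]
    simpa only [Function.iterate_add_apply] using hk.2

theorem iterate_mem_planeBasin {z : ℂ} (hz : z ∈ planeBasin t ξ) (k : ℕ) :
    t^[k] z ∈ planeBasin t ξ := by
  refine ⟨fun j => ?_, ?_⟩
  · rw [← Function.iterate_add_apply]; exact hz.1 _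
  · have := (tendsto_add_atTop_iff_nat k).mpr hz.2
    simpa only [Function.iterate_add_apply] using this

/-- The derivative at `ξ` vanishes, so `t` halves distances to `ξ` nearby. All radii up to `r` are
covered because the maximum principle later loses a strict inequality between `r / 2` and `r`. -/
theorem exists_ball_subset_planeBasin (hξ : ξ ≠ 0) (hfix : t ξ = ξ) (hd : HasDerivAt t 0 ξ) :
    ∃ r > 0, ∀ s ≤ r, Set.MapsTo t (Metric.ball ξ s) (Metric.ball ξ s) ∧
      Metric.ball ξ s ⊆ planeBasin t ξ := by
  have h1 : ∀ᶠ z in 𝓝 ξ, ‖t z - ξ‖ ≤ 1 / 2 * ‖z - ξ‖ := by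
    have := (hasDerivAt_iff_isLittleO.mp hd).def (c := 1 / 2) (by norm_num)
    simpa [hfix] using this
  obtain ⟨r, hr, h⟩ := Metric.eventually_nhds_iff_ball.mp (h1.and (isOpen_ne.eventually_mem hξ))
  have maps : ∀ s ≤ r, Set.MapsTo t (Metric.ball ξ s) (Metric.ball ξ s) := fun s hs z hz => by
    have h3 := (h z (Metric.ball_subset_ball hs hz)).1
    rw [Metric.mem_ball, dist_eq_norm] at hz ⊢
    linarith [norm_nonneg (z - ξ)]
  refine ⟨r, hr, fun s hs => ⟨maps s hs, fun z hz => ?_⟩⟩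
  have hball : ∀ k : ℕ, t^[k] z ∈ Metric.ball ξ r := fun k =>
    Metric.ball_subset_ball hs ((maps s hs).iterate k hz)
  have key : ∀ k : ℕ, ‖t^[k] z - ξ‖ ≤ (1 / 2) ^ k * ‖z - ξ‖ := by
    intro k
    induction k with
    | zero => simp
    | succ k ih =>
      rw [Function.iterate_succ_apply', pow_succ]
      nlinarith [(h _ (hball k)).1]
  refine ⟨fun k => (h _ (hball k)).2, ?_⟩
  rw [tendsto_iff_norm_sub_tendsto_zero]
  refine squeeze_zero (fun _ => norm_nonneg _) key ?_
  have := (tendsto_pow_atTop_nhds_zero_of_lt_one (r := (1 / 2 : ℝ)) (by norm_num)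
    (by norm_num)).mul_const ‖z - ξ‖
  simpa using this

theorem isOpen_iterate_mem_ball (ht : ∀ z ≠ 0, DifferentiableAt ℂ t z) (r : ℝ) (k : ℕ) :
    IsOpen {z | (∀ j < k, t^[j] z ≠ 0) ∧ t^[k] z ∈ Metric.ball ξ r} := by
  refine isOpen_iff_mem_nhds.mpr fun z hz => ?_
  have h1 : ∀ᶠ y in 𝓝 z, ∀ j ∈ Finset.range k, t^[j] y ≠ 0 := by
    rw [Filter.eventually_all_finset]
    intro j hj
    have hj' := Finset.mem_range.mp hj
    exact (differentiableAt_iterate ht fun i hi => hz.1 i (hi.trans hj')).continuousAt.eventually_ne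
      (hz.1 j hj')
  have h2 := (differentiableAt_iterate ht hz.1).continuousAt.eventually
    (Metric.isOpen_ball.eventually_mem hz.2)
  filter_upwards [h1, h2] with y h3 h4
  exact ⟨fun j hj => h3 j (Finset.mem_range.mpr hj), h4⟩

theorem isOpen_planeBasin (ht : ∀ z ≠ 0, DifferentiableAt ℂ t z) (hξ : ξ ≠ 0) (hfix : t ξ = ξ)
    (hd : HasDerivAt t 0 ξ) : IsOpen (planeBasin t ξ) := by
  obtain ⟨r, hr, hB⟩ := exists_ball_subset_planeBasin hξ hfix hd
  replace hB := (hB r le_rfl).2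
  refine isOpen_iff_mem_nhds.mpr fun z hz => ?_
  obtain ⟨k, hk⟩ := (hz.2.eventually (Metric.ball_mem_nhds ξ hr)).exists
  filter_upwards [(isOpen_iterate_mem_ball ht r k).mem_nhds ⟨fun j _ => hz.1 j, hk⟩] with y hy
  exact mem_planeBasin_of_iterate hy.1 (hB hy.2)

/-- A continuum in the basin of one root does not surround the origin, since its rotated copy
would have to cross it. -/
theorem not_isBounded_component_zero {ω : ℂ} (hω1 : ‖ω‖ = 1) (hω : ω ≠ 1)
    (hrot : ∀ z ≠ 0, t (ω * z) = ω * t z) (hξ : ξ ≠ 0) {σ : Set ℂ} (hσ : σ ⊆ planeBasin t ξ)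
    (hσc : IsCompact σ) (hσconn : IsConnected σ) :
    ¬ Bornology.IsBounded (connectedComponentIn σᶜ 0) := by
  intro hb
  have hω0 : ω ≠ 0 := fun h => by simp [h] at hω1
  have hσ0 : (0 : ℂ) ∈ σᶜ := fun h => (hσ h).1 0 rfl
  -- The orbit of `ω * z` converges to `ω * ξ ≠ ξ`.
  have hdisj : ∀ z ∈ σ, ω * z ∈ σᶜ := by
    intro z hz hz'
    have hz1 := hσ hz
    have hit : ∀ k : ℕ, t^[k] (ω * z) = ω * t^[k] z := by
      intro k
      induction k with
      | zero => rfl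
      | succ k ih => rw [Function.iterate_succ_apply', ih, hrot _ (hz1.1 k),
          Function.iterate_succ_apply']
    have h1 := (hσ hz').2
    simp only [hit] at h1
    have h2 := tendsto_nhds_unique h1 (hz1.2.const_mul ω)
    exact hω (mul_right_cancel₀ hξ (by rw [one_mul]; exact h2.symm))
  obtain ⟨z₀, hz₀, hmin⟩ := hσc.exists_isMinOn hσconn.nonempty continuous_norm.continuousOn
  obtain ⟨z₁, hz₁, hmax⟩ := hσc.exists_isMaxOn hσconn.nonempty continuous_norm.continuousOn
  -- No point of `σ` has modulus below that of `z₀`, so this segment joins `0` to the rotated copy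
  -- inside `σᶜ`. Likewise the outward ray from `ω * z₁` stays in `σᶜ`, which makes the component of
  -- `0` unbounded.
  have hseg : (fun s : ℝ => (s : ℂ) * (ω * z₀)) '' Set.Icc 0 1 ⊆ connectedComponentIn σᶜ 0 := by
    refine IsPreconnected.subset_connectedComponentIn
      (isPreconnected_Icc.image _ (Continuous.continuousOn (by fun_prop)))
      ⟨0, by simp, by simp⟩ ?_
    rintro _ ⟨s, hs, rfl⟩ hmem
    rcases hs.2.eq_or_lt with rfl | hs1
    · exact hdisj z₀ hz₀ (by simpa using hmem)
    · have h1 : ‖z₀‖ ≤ ‖(s : ℂ) * (ω * z₀)‖ := hmin hmem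
      have h2 : 0 < ‖z₀‖ := norm_pos_iff.mpr fun h => (hσ hz₀).1 0 h
      rw [norm_mul, norm_mul, hω1, Complex.norm_real, Real.norm_of_nonneg hs.1] at h1
      nlinarith
  have hrotσ : (fun z => ω * z) '' σ ⊆ connectedComponentIn σᶜ 0 := by
    have h1 : ω * z₀ ∈ connectedComponentIn σᶜ 0 := hseg ⟨1, by simp, by simp⟩
    rw [connectedComponentIn_eq h1]
    refine IsPreconnected.subset_connectedComponentIn
      (hσconn.isPreconnected.image _ (Continuous.continuousOn (by fun_prop))) ⟨z₀, hz₀, rfl⟩ ?_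
    rintro _ ⟨z, hz, rfl⟩
    exact hdisj z hz
  have hray : (fun s : ℝ => (s : ℂ) * (ω * z₁)) '' Set.Ici 1 ⊆ connectedComponentIn σᶜ 0 := by
    rw [connectedComponentIn_eq (hrotσ ⟨z₁, hz₁, rfl⟩)]
    refine IsPreconnected.subset_connectedComponentIn
      (isPreconnected_Ici.image _ (Continuous.continuousOn (by fun_prop)))
      ⟨1, by simp, by simp⟩ ?_
    rintro _ ⟨s, hs, rfl⟩ hmem
    rcases (show (1 : ℝ) ≤ s from hs).eq_or_lt with rfl | hs1
    · exact hdisj z₁ hz₁ (by simpa using hmem)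
    · have h1 : ‖(s : ℂ) * (ω * z₁)‖ ≤ ‖z₁‖ := hmax hmem
      have h2 : 0 < ‖z₁‖ := norm_pos_iff.mpr fun h => (hσ hz₁).1 0 h
      rw [norm_mul, norm_mul, hω1, Complex.norm_real, Real.norm_of_nonneg (by linarith)] at h1
      nlinarith
  obtain ⟨R, hR⟩ := (hb.subset hray).subset_closedBall 0
  have h2 : 0 < ‖z₁‖ := norm_pos_iff.mpr fun h => (hσ hz₁).1 0 h
  have h3 := hR ⟨max 1 (|R| / ‖z₁‖ + 1), Set.mem_Ici.mpr (le_max_left _ _), rfl⟩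
  rw [Metric.mem_closedBall, dist_zero_right, norm_mul, norm_mul, hω1, Complex.norm_real,
    Real.norm_of_nonneg (by positivity), one_mul] at h3
  have h4 : (|R| / ‖z₁‖ + 1) * ‖z₁‖ ≤ R :=
    (mul_le_mul_of_nonneg_right (le_max_right _ _) h2.le).trans h3
  rw [add_mul, div_mul_cancel₀ _ h2.ne'] at h4
  linarith [le_abs_self R]

/-- Either a first iterate vanishes somewhere in the hole `V`, and its image of `K` surrounds `0`,
or all iterates are holomorphic on `V` and the maximum principle puts `closure V` in the basin. -/
theorem fillsHoles_component_planeBasin (ht : ∀ z ≠ 0, DifferentiableAt ℂ t z) (hξ : ξ ≠ 0)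
    (hfix : t ξ = ξ) (hd : HasDerivAt t 0 ξ) {ω : ℂ} (hω1 : ‖ω‖ = 1) (hω : ω ≠ 1)
    (hrot : ∀ z ≠ 0, t (ω * z) = ω * t z) :
    FillsHoles (connectedComponentIn (planeBasin t ξ) ξ) := by
  intro K hKU hKc hKconn z hz hbdd
  set U := connectedComponentIn (planeBasin t ξ) ξ with hU
  set V := connectedComponentIn Kᶜ z with hV
  have hUB : U ⊆ planeBasin t ξ := connectedComponentIn_subset _ _
  have hVo : IsOpen V := hKc.isClosed.isOpen_compl.connectedComponentIn
  have hzV : z ∈ V := mem_connectedComponentIn hz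
  have hcl : closure V ⊆ V ∪ K := closure_connectedComponentIn_compl_subset hKc.isClosed z
  have hfr : frontier V ⊆ K := fun x hx =>
    (hcl hx.1).resolve_left fun h => hx.2 (hVo.interior_eq.symm ▸ h)
  obtain ⟨y, hy⟩ : (frontier V).Nonempty := by
    rw [nonempty_frontier_iff]
    exact ⟨⟨z, hzV⟩, fun h => NormedSpace.unbounded_univ ℂ ℂ (h ▸ hbdd)⟩
  have hclc : IsCompact (closure V) := hbdd.isCompact_closure
  have diff : ∀ k : ℕ, (∀ j < k, ∀ x ∈ V, t^[j] x ≠ 0) → ∀ x ∈ closure V,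
      DifferentiableAt ℂ t^[k] x := by
    intro k hk x hx
    refine differentiableAt_iterate ht fun j hj => ?_
    rcases hcl hx with h | h
    · exact hk j hj x h
    · exact (hUB (hKU h)).1 j
  have hcont : ∀ k : ℕ, ContinuousOn t^[k] K := fun k x hx =>
    (differentiableAt_iterate ht fun j _ => (hUB (hKU hx)).1 j).continuousAt.continuousWithinAt
  by_cases hcase : ∃ k : ℕ, ∃ x ∈ V, t^[k] x = 0
  · exfalso
    classical
    set k := Nat.find hcase
    obtain ⟨x, hxV, hx0⟩ := Nat.find_spec hcase
    have hk : ∀ j < k, ∀ x ∈ V, t^[j] x ≠ 0 := fun j hj x hx h0 =>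
      Nat.find_min hcase hj ⟨x, hx, h0⟩
    have hfc : ContinuousOn t^[k] (closure V) := fun x hx =>
      (diff k hk x hx).continuousAt.continuousWithinAt
    have han : AnalyticOnNhd ℂ t^[k] V := DifferentiableOn.analyticOnNhd
      (fun x hx => (diff k hk x (subset_closure hx)).differentiableWithinAt) hVo
    -- A constant iterate would be `0` on `closure V` too, hence at a boundary point, which lies in
    -- `K` and so in the basin.
    rcases han.is_constant_or_isOpen isPreconnected_connectedComponentIn with ⟨c, hc⟩ | hopen
    · have hc0 : c = 0 := (hc x hxV).symm.trans hx0
      have h1 : Set.EqOn t^[k] (fun _ => c) (closure V) :=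
        Set.EqOn.of_subset_closure hc hfc continuousOn_const subset_closure subset_rfl
      exact (hUB (hKU (hfr hy))).1 k ((h1 hy.1).trans hc0)
    · have hVim : IsOpen (t^[k] '' V) := hopen V subset_rfl hVo
      have hclim : IsCompact (t^[k] '' closure V) := hclc.image_of_continuousOn hfc
      have hσB : t^[k] '' K ⊆ planeBasin t ξ := by
        rintro _ ⟨w, hw, rfl⟩; exact iterate_mem_planeBasin (hUB (hKU hw)) k
      refine not_isBounded_component_zero hω1 hω hrot hξ hσB (hKc.image_of_continuousOn (hcont k))
        (hKconn.image _ (hcont k)) ?_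
      refine hclim.isBounded.subset (subset_trans ?_ (Set.image_mono subset_closure))
      -- Off `σ`, the image of `V` and the complement of the image of `closure V` are disjoint open
      -- sets that cover; the component of `0` lies in the first, which is bounded.
      refine isPreconnected_connectedComponentIn.subset_left_of_subset_union
        (v := (t^[k] '' closure V)ᶜ) hVim hclim.isClosed.isOpen_compl ?_ ?_ ?_
      · exact Set.disjoint_left.mpr fun w hw hw' => hw' (Set.image_mono subset_closure hw)
      · intro w hw
        by_cases h : w ∈ t^[k] '' closure V
        · obtain ⟨v, hv, rfl⟩ := h
          rcases hcl hv with h1 | h1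
          · exact Or.inl ⟨v, h1, rfl⟩
          · exact absurd ⟨v, h1, rfl⟩ (connectedComponentIn_subset _ _ hw)
        · exact Or.inr h
      · exact ⟨0, mem_connectedComponentIn fun h => (hσB h).1 0 rfl, x, hxV, hx0⟩
  · push Not at hcase
    obtain ⟨r, hr, hball⟩ := exists_ball_subset_planeBasin hξ hfix hd
    obtain ⟨hmaps, hsub⟩ := hball (r / 2) (by linarith)
    -- Compactness gives one `k` for which the `k`-th iterate sends all of `K` into the small disc;
    -- the cover is directed because that disc is invariant.
    obtain ⟨k, hk⟩ := hKc.elim_directed_cover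
      (fun k => {z | (∀ j < k, t^[j] z ≠ 0) ∧ t^[k] z ∈ Metric.ball ξ (r / 2)})
      (isOpen_iterate_mem_ball ht (r / 2))
      (fun x hx => by
        have hx := hUB (hKU hx)
        obtain ⟨k, hk⟩ := (hx.2.eventually (Metric.ball_mem_nhds ξ (half_pos hr))).exists
        exact Set.mem_iUnion.mpr ⟨k, fun j _ => hx.1 j, hk⟩)
      (directed_of_isDirected_le fun i j hij x hx => by
        refine ⟨fun m _ => (mem_planeBasin_of_iterate hx.1 (hsub hx.2)).1 m, ?_⟩
        have := hmaps.iterate (j - i) hx.2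
        rwa [← Function.iterate_add_apply, Nat.sub_add_cancel hij] at this)
    have hd' := diff k fun j _ x hx => hcase j x hx
    have hle : ∀ x ∈ closure V, ‖t^[k] x - ξ‖ ≤ r / 2 := by
      intro x hx
      refine Complex.norm_le_of_forall_mem_frontier_norm_le (f := fun x => t^[k] x - ξ) hbdd
        (DifferentiableOn.diffContOnCl fun w hw =>
          ((hd' w hw).sub_const ξ).differentiableWithinAt) (fun w hw => ?_) hx
      have := (hk (hfr hw)).2
      rw [Metric.mem_ball, dist_eq_norm] at this
      exact this.le
    have hclB : closure V ⊆ planeBasin t ξ := by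
      intro x hx
      refine mem_planeBasin_of_iterate (k := k) (fun j _ => ?_) ((hball r le_rfl).2 ?_)
      · rcases hcl hx with h | h
        · exact hcase j x h
        · exact (hUB (hKU h)).1 j
      · rw [Metric.mem_ball, dist_eq_norm]
        linarith [hle x hx]
    have hyU := hKU (hfr hy)
    rw [hU, connectedComponentIn_eq hyU]
    exact isPreconnected_connectedComponentIn.closure.subset_connectedComponentIn hy.1 hclB
      (subset_closure hzV)

theorem isSimplyConnected_component_planeBasin (ht : ∀ z ≠ 0, DifferentiableAt ℂ t z)
    (hξ : ξ ≠ 0) (hfix : t ξ = ξ) (hd : HasDerivAt t 0 ξ) {ω : ℂ} (hω1 : ‖ω‖ = 1) (hω : ω ≠ 1)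
    (hrot : ∀ z ≠ 0, t (ω * z) = ω * t z) :
    IsSimplyConnected (connectedComponentIn (planeBasin t ξ) ξ) := by
  obtain ⟨r, hr, hball⟩ := exists_ball_subset_planeBasin hξ hfix hd
  exact (fillsHoles_component_planeBasin ht hξ hfix hd hω1 hω hrot).isSimplyConnected
    (isOpen_planeBasin ht hξ hfix hd).connectedComponentIn
    (isConnected_connectedComponentIn_iff.mpr ((hball r le_rfl).2 (Metric.mem_ball_self hr)))

end Dynamics

/-! ### Passage from the plane to the sphere -/

theorem Topology.IsOpenEmbedding.connectedComponentIn_image {X Y : Type*} [TopologicalSpace X]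
    [TopologicalSpace Y] {f : X → Y} (hf : IsOpenEmbedding f) {s : Set X} {x : X} (hx : x ∈ s) :
    connectedComponentIn (f '' s) (f x) = f '' connectedComponentIn s x := by
  refine Set.Subset.antisymm ?_ ?_
  · have hsub : connectedComponentIn (f '' s) (f x) ⊆ f '' s := connectedComponentIn_subset _ _
    have hpre := isPreconnected_connectedComponentIn.preimage_of_isOpenMap
      (s := connectedComponentIn (f '' s) (f x)) hf.injective hf.isOpenMap
      (hsub.trans (Set.image_subset_range f s))
    have h1 : f ⁻¹' connectedComponentIn (f '' s) (f x) ⊆ connectedComponentIn s x := by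
      refine hpre.subset_connectedComponentIn (mem_connectedComponentIn ⟨x, hx, rfl⟩) fun y hy => ?_
      obtain ⟨y', hy', e⟩ := hsub hy
      exact hf.injective e ▸ hy'
    intro y hy
    obtain ⟨y', -, rfl⟩ := hsub hy
    exact ⟨y', h1 hy, rfl⟩
  · exact (isPreconnected_connectedComponentIn.image f hf.continuous.continuousOn
      ).subset_connectedComponentIn ⟨x, mem_connectedComponentIn hx, rfl⟩
      (Set.image_mono (connectedComponentIn_subset _ _))

section SphereMap

variable {R : RatFunc ℂ} {A : ℂ[X]} {c : ℂ} {m : ℕ}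

theorem exists_denom_eq_X_pow_of_eq_div (hc : c ≠ 0)
    (hR : R = algebraMap ℂ[X] (RatFunc ℂ) A / algebraMap ℂ[X] (RatFunc ℂ) (C c * X ^ m)) :
    ∃ j : ℕ, R.denom = X ^ j ∧ R.num * (C c * X ^ m) = A * X ^ j := by
  have hB : (C c * X ^ m : ℂ[X]) ≠ 0 := mul_ne_zero (C_ne_zero.mpr hc) (pow_ne_zero _ X_ne_zero)
  have h1 : R.denom ∣ C c * X ^ m := by rw [hR]; exact RatFunc.denom_div_dvd _ _
  have h2 : R.denom ∣ X ^ m :=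
    (IsUnit.dvd_mul_left (Polynomial.isUnit_C.mpr (isUnit_iff_ne_zero.mpr hc))).mp h1
  obtain ⟨j, -, hj⟩ := (dvd_prime_pow prime_X m).mp h2
  have h3 : R.denom = X ^ j :=
    eq_of_monic_of_associated (RatFunc.monic_denom R) (monic_X_pow j) hj
  refine ⟨j, h3, ?_⟩
  have h4 := (RatFunc.num_div_denom R).trans hR
  rw [div_eq_div_iff (RatFunc.algebraMap_ne_zero R.denom_ne_zero)
    (RatFunc.algebraMap_ne_zero hB), ← map_mul, ← map_mul] at h4
  rw [← h3]
  exact RatFunc.algebraMap_injective ℂ h4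

theorem sphereMap_coe_of_ne_zero (hc : c ≠ 0)
    (hR : R = algebraMap ℂ[X] (RatFunc ℂ) A / algebraMap ℂ[X] (RatFunc ℂ) (C c * X ^ m))
    {z : ℂ} (hz : z ≠ 0) :
    sphereMap R (z : OnePoint ℂ) = ((A.eval z / (c * z ^ m) : ℂ) : OnePoint ℂ) := by
  obtain ⟨j, hj, hnum⟩ := exists_denom_eq_X_pow_of_eq_div hc hR
  have h1 : R.denom.eval z ≠ 0 := by rw [hj]; simpa using pow_ne_zero j hz
  have h2 := congrArg (Polynomial.eval z) hnum
  simp only [eval_mul, eval_C, eval_pow, eval_X] at h2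
  change (if R.denom.eval z = 0 then _ else _) = _
  rw [if_neg h1, hj, eval_pow, eval_X]
  congr 1
  rw [div_eq_div_iff (pow_ne_zero _ hz) (mul_ne_zero hc (pow_ne_zero _ hz)), h2]

/-- In lowest terms the denominator is `X ^ j`, and `hA` becomes the vanishing of coefficient `j` of
the numerator. That coefficient determines the value at `0` (when `j = 0`) and the value at `∞`,
whenever these are finite. -/
theorem sphereMap_zero_infty (hc : c ≠ 0) (hA : A.coeff m = 0)
    (hR : R = algebraMap ℂ[X] (RatFunc ℂ) A / algebraMap ℂ[X] (RatFunc ℂ) (C c * X ^ m))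
    {y : OnePoint ℂ} (hy : y = ((0 : ℂ) : OnePoint ℂ) ∨ y = OnePoint.infty) :
    sphereMap R y = ((0 : ℂ) : OnePoint ℂ) ∨ sphereMap R y = OnePoint.infty := by
  obtain ⟨j, hj, hnum⟩ := exists_denom_eq_X_pow_of_eq_div hc hR
  have hcoeff : R.num.coeff j = 0 := by
    have h2 := congrArg (fun p => Polynomial.coeff p (j + m)) hnum
    simp only [mul_comm (C c), ← mul_assoc, coeff_mul_C, coeff_mul_X_pow] at h2
    rw [add_comm j m, coeff_mul_X_pow, hA] at h2
    exact (mul_eq_zero.mp h2).resolve_right hc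
  rcases hy with rfl | rfl
  · by_cases h0 : R.denom.eval 0 = 0
    · right
      change (if R.denom.eval 0 = 0 then _ else _) = _
      rw [if_pos h0]
    · left
      change (if R.denom.eval 0 = 0 then _ else _) = _
      rw [if_neg h0]
      obtain rfl : j = 0 := by
        by_contra hj0
        exact h0 (by rw [hj]; simp [hj0])
      rw [← coeff_zero_eq_eval_zero, hcoeff, zero_div]
  · by_cases h0 : R.denom.natDegree < R.num.natDegree
    · right
      change (if R.denom.natDegree < R.num.natDegree then _ else _) = _
      rw [if_pos h0]
    · left
      change (if R.denom.natDegree < R.num.natDegree then _ else _) = _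
      rw [if_neg h0, hj, natDegree_X_pow, hcoeff, zero_div]

end SphereMap

theorem basin_eq_image_planeBasin {R : RatFunc ℂ} {t : ℂ → ℂ} {ξ : ℂ} (hξ : ξ ≠ 0)
    (hF : ∀ z : ℂ, z ≠ 0 → sphereMap R (z : OnePoint ℂ) = (t z : OnePoint ℂ))
    (hF0 : ∀ y : OnePoint ℂ, y = ((0 : ℂ) : OnePoint ℂ) ∨ y = OnePoint.infty →
      sphereMap R y = ((0 : ℂ) : OnePoint ℂ) ∨ sphereMap R y = OnePoint.infty) :
    basin R ξ = ((↑) : ℂ → OnePoint ℂ) '' planeBasin t ξ := by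
  set F := sphereMap R
  -- An orbit that enters the closed set `{0, ∞}` stays there, so its limit cannot be `ξ`.
  have hstay : ∀ (y : OnePoint ℂ), y = ((0 : ℂ) : OnePoint ℂ) ∨ y = OnePoint.infty →
      ¬ Tendsto (fun k : ℕ => F^[k] y) atTop (𝓝 (ξ : OnePoint ℂ)) := by
    intro y hy hlim
    have h1 : ∀ k : ℕ, F^[k] y ∈ ({((0 : ℂ) : OnePoint ℂ), OnePoint.infty} : Set (OnePoint ℂ)) := by
      intro k
      induction k with
      | zero => exact hy
      | succ k ih => rw [Function.iterate_succ_apply']; exact hF0 _ ih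
    have h2 := (Set.toFinite {((0 : ℂ) : OnePoint ℂ), OnePoint.infty}).isClosed.mem_of_tendsto
      hlim (Eventually.of_forall h1)
    rcases h2 with h2 | h2
    · exact hξ (OnePoint.coe_injective h2)
    · exact OnePoint.coe_ne_infty ξ h2
  have hcoe : ∀ {z : ℂ} {k : ℕ}, (∀ j < k, t^[j] z ≠ 0) →
      F^[k] (z : OnePoint ℂ) = (t^[k] z : ℂ) := by
    intro z k hz
    induction k with
    | zero => rfl
    | succ k ih =>
      rw [Function.iterate_succ_apply', ih fun j hj => hz j (hj.trans (Nat.lt_succ_self k)),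
        hF _ (hz k (Nat.lt_succ_self k)), Function.iterate_succ_apply']
  ext y
  constructor
  · intro hy
    have hy' : Tendsto (fun k : ℕ => F^[k] y) atTop (𝓝 (ξ : OnePoint ℂ)) := hy
    induction y using OnePoint.rec with
    | infty => exact absurd hy' (hstay _ (Or.inr rfl))
    | coe z =>
      have hz : ∀ k : ℕ, t^[k] z ≠ 0 := by
        intro k
        induction k using Nat.strong_induction_on with
        | _ k ih =>
          intro h0
          refine hstay (F^[k] z) (Or.inl (by rw [hcoe ih, h0])) ?_
          have := (tendsto_add_atTop_iff_nat k).mpr hy'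
          simpa only [Function.iterate_add_apply] using this
      refine ⟨z, ⟨hz, ?_⟩, rfl⟩
      rw [OnePoint.isOpenEmbedding_coe.isInducing.tendsto_nhds_iff]
      exact hy'.congr fun k => hcoe fun j _ => hz j
  · rintro ⟨z, hz, rfl⟩
    have h1 := (OnePoint.isOpenEmbedding_coe.isInducing.tendsto_nhds_iff).mp hz.2
    exact h1.congr fun k => (hcoe fun j _ => hz.1 j).symm

/-! ### The damped Traub map of `z ^ n - 1` -/

section Traub

/-- Newton's map of `z ^ n - 1` on the plane. -/
noncomputable def newtonPlane (n : ℕ) (z : ℂ) : ℂ := z - (z ^ n - 1) / (n * z ^ (n - 1))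

/-- The damped Traub map of `z ^ n - 1` on the plane. -/
noncomputable def traubPlane (n : ℕ) (δ z : ℂ) : ℂ :=
  newtonPlane n z - δ * ((newtonPlane n z ^ n - 1) / (n * z ^ (n - 1)))

variable {n : ℕ} (δ : ℂ)

theorem newtonPlane_mul {ω : ℂ} (hn : 1 ≤ n) (hω : ω ^ n = 1) (z : ℂ) :
    newtonPlane n (ω * z) = ω * newtonPlane n z := by
  have hω0 : ω ^ (n - 1) * ω = 1 := by rw [← pow_succ, Nat.sub_add_cancel hn, hω]
  have h1 : (ω ^ (n - 1))⁻¹ = ω := inv_eq_of_mul_eq_one_right hω0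
  unfold newtonPlane
  rw [mul_pow, mul_pow, hω, one_mul, div_eq_mul_inv, div_eq_mul_inv]
  simp only [mul_inv, h1]
  ring

theorem traubPlane_mul {ω : ℂ} (hn : 1 ≤ n) (hω : ω ^ n = 1) (z : ℂ) :
    traubPlane n δ (ω * z) = ω * traubPlane n δ z := by
  have hω0 : ω ^ (n - 1) * ω = 1 := by rw [← pow_succ, Nat.sub_add_cancel hn, hω]
  have h1 : (ω ^ (n - 1))⁻¹ = ω := inv_eq_of_mul_eq_one_right hω0
  unfold traubPlane
  rw [newtonPlane_mul hn hω, mul_pow, mul_pow, hω, one_mul, div_eq_mul_inv, div_eq_mul_inv]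
  simp only [mul_inv, h1]
  ring

theorem differentiableAt_traubPlane (hn : n ≠ 0) {z : ℂ} (hz : z ≠ 0) :
    DifferentiableAt ℂ (traubPlane n δ) z := by
  have hb : (n : ℂ) * z ^ (n - 1) ≠ 0 :=
    mul_ne_zero (Nat.cast_ne_zero.mpr hn) (pow_ne_zero _ hz)
  have hb' : DifferentiableAt ℂ (fun z : ℂ => (n : ℂ) * z ^ (n - 1)) z := by fun_prop
  have h1 : DifferentiableAt ℂ (newtonPlane n) z :=
    differentiableAt_id.sub (((differentiableAt_id.pow n).sub_const 1).div hb' hb)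
  exact h1.sub ((((h1.pow n).sub_const 1).div hb' hb).const_mul δ)

theorem newtonPlane_root {ξ : ℂ} (hξ : ξ ^ n = 1) : newtonPlane n ξ = ξ := by
  simp [newtonPlane, hξ]

theorem traubPlane_root {ξ : ℂ} (hξ : ξ ^ n = 1) : traubPlane n δ ξ = ξ := by
  simp [traubPlane, newtonPlane_root hξ, hξ]

/-- Newton's map is critical at a simple root; by the chain rule so is `p ∘ N`, which also vanishes
there, so the correction has derivative `0` for every `δ`. -/
theorem hasDerivAt_traubPlane_root (hn : n ≠ 0) {ξ : ℂ} (hξ : ξ ^ n = 1) :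
    HasDerivAt (traubPlane n δ) 0 ξ := by
  have hξ0 : ξ ≠ 0 := fun h => by simp [h, hn] at hξ
  have hb : (n : ℂ) * ξ ^ (n - 1) ≠ 0 :=
    mul_ne_zero (Nat.cast_ne_zero.mpr hn) (pow_ne_zero _ hξ0)
  obtain ⟨b', hb'⟩ : ∃ b', HasDerivAt (fun z : ℂ => (n : ℂ) * z ^ (n - 1)) b' ξ :=
    ⟨_, ((hasDerivAt_pow (n - 1) ξ).const_mul _)⟩
  have h1 : HasDerivAt (newtonPlane n) 0 ξ := by
    have h2 := (hasDerivAt_id ξ).sub (((hasDerivAt_pow n ξ).sub_const 1).div hb' hb)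
    refine HasDerivAt.congr_deriv h2 ?_
    rw [hξ]
    field_simp
    ring
  have h3 : HasDerivAt (fun z => newtonPlane n z ^ n - 1) 0 ξ := by
    simpa using (h1.pow n).sub_const 1
  have h4 := h1.sub ((h3.div hb' hb).const_mul δ)
  refine HasDerivAt.congr_deriv h4 ?_
  simp [newtonPlane_root hξ, hξ]

theorem div_sub_mul_div_pow_sub_one {K : Type*} [Field K] {b : K} (hb : b ≠ 0) (x d : K) (n : ℕ) :
    x / b - d * (((x / b) ^ n - 1) / b) = (x * b ^ n - d * (x ^ n - b ^ n)) / b ^ (n + 1) := by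
  rw [div_pow, pow_succ]
  field_simp

/-- The vanishing coefficient is the algebraic form of the rotation symmetry: `A` is a polynomial in
`X ^ n`, while `(n - 1) * (n + 1) = n ^ 2 - 1` is not a multiple of `n`. -/
theorem dampedTraub_eq_div (hn1 : 2 ≤ n) :
    ∃ A : ℂ[X], A.coeff ((n - 1) * (n + 1)) = 0 ∧
      dampedTraub (X ^ n - 1 : ℂ[X]) δ = algebraMap ℂ[X] (RatFunc ℂ) A /
        algebraMap ℂ[X] (RatFunc ℂ) (C ((n : ℂ) ^ (n + 1)) * X ^ ((n - 1) * (n + 1))) ∧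
      ∀ z : ℂ, z ≠ 0 →
        A.eval z / ((n : ℂ) ^ (n + 1) * z ^ ((n - 1) * (n + 1))) = traubPlane n δ z := by
  have hn : 1 ≤ n := by omega
  have hn0 : (n : ℂ) ≠ 0 := Nat.cast_ne_zero.mpr (by omega)
  set a : ℂ[X] := C ((n : ℂ) - 1) * X ^ n + 1 with ha
  set b : ℂ[X] := C (n : ℂ) * X ^ (n - 1) with hb
  have hbX : b * X = C (n : ℂ) * X ^ n := by
    rw [hb, mul_assoc, ← pow_succ, Nat.sub_add_cancel hn]
  have hb0 : b ≠ 0 := mul_ne_zero (C_ne_zero.mpr hn0) (pow_ne_zero _ X_ne_zero)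
  have hder : derivative (X ^ n - 1 : ℂ[X]) = b := by
    simp [hb, derivative_X_pow]
  have hbpow : C ((n : ℂ) ^ (n + 1)) * X ^ ((n - 1) * (n + 1)) = b ^ (n + 1) := by
    rw [hb, mul_pow, ← pow_mul, C_pow]
  refine ⟨a * b ^ n - C δ * (a ^ n - b ^ n), ?_, ?_, ?_⟩
  · have e : a * b ^ n - C δ * (a ^ n - b ^ n) = expand ℂ n
        ((C ((n : ℂ) - 1) * X + 1) * (C ((n : ℂ) ^ n) * X ^ (n - 1)) -
          C δ * ((C ((n : ℂ) - 1) * X + 1) ^ n - C ((n : ℂ) ^ n) * X ^ (n - 1))) := by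
      simp only [map_sub, map_mul, map_add, map_pow, expand_C, expand_X, map_one, ha, hb, mul_pow,
        ← pow_mul]
      rw [mul_comm (n - 1) n]
    rw [e, coeff_expand (by omega), if_neg]
    intro hdvd
    have h1 : (n - 1) * (n + 1) + 1 = n * n := by
      obtain ⟨k, rfl⟩ := Nat.exists_eq_add_of_le hn
      simp only [Nat.add_sub_cancel_left]; ring
    have h2 : n ∣ 1 := (Nat.dvd_add_right hdvd).mp (h1 ▸ dvd_mul_right n n)
    exact absurd (Nat.dvd_one.mp h2) (by omega)
  · have hbA : algebraMap ℂ[X] (RatFunc ℂ) b ≠ 0 := RatFunc.algebraMap_ne_zero hb0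
    have hN : newtonRatFunc (X ^ n - 1 : ℂ[X]) =
        algebraMap ℂ[X] (RatFunc ℂ) a / algebraMap ℂ[X] (RatFunc ℂ) b := by
      rw [newtonRatFunc, hder, eq_div_iff hbA, sub_mul, div_mul_cancel₀ _ hbA,
        ← RatFunc.algebraMap_X, ← map_mul, ← map_sub]
      congr 1
      rw [mul_comm, hbX, ha, C_sub, C_1]
      ring
    rw [dampedTraub, hN, hder, hbpow, ← RatFunc.algebraMap_C]
    simp only [map_sub, map_mul, map_pow, map_one, aeval_X]
    exact div_sub_mul_div_pow_sub_one hbA _ _ _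
  · intro z hz
    have hbz : (n : ℂ) * z ^ (n - 1) ≠ 0 := mul_ne_zero hn0 (pow_ne_zero _ hz)
    have hN : newtonPlane n z = a.eval z / (n * z ^ (n - 1)) := by
      rw [newtonPlane, eq_div_iff hbz, sub_mul, div_mul_cancel₀ _ hbz]
      have : z * (n * z ^ (n - 1)) = n * z ^ n := by
        rw [mul_left_comm, ← pow_succ', Nat.sub_add_cancel hn]
      rw [this]
      simp [ha]
      ring
    have hbe : b.eval z = n * z ^ (n - 1) := by simp [hb]
    have e : (n : ℂ) ^ (n + 1) * z ^ ((n - 1) * (n + 1)) = (n * z ^ (n - 1)) ^ (n + 1) := by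
      rw [mul_pow, ← pow_mul]
    rw [e, traubPlane, hN]
    simp only [eval_sub, eval_mul, eval_pow, eval_C, hbe]
    exact (div_sub_mul_div_pow_sub_one hbz _ _ _).symm

end Traub

/-- For every `n ≥ 3`, every complex `δ` and every `n`-th root of unity `ξ`, the immediate basin
of `ξ` under the damped Traub map of `z ^ n - 1` is simply connected. -/
theorem mainTheorem3 (n : ℕ) (hn : 3 ≤ n) (δ : ℂ) (ξ : ℂ) (hξ : ξ ^ n = 1) :
    IsSimplyConnected
      (immediateBasin (dampedTraub (X ^ n - 1 : ℂ[X]) δ) (ξ : OnePoint ℂ)) := by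
  have hn0 : n ≠ 0 := by omega
  have hξ0 : ξ ≠ 0 := fun h => by simp [h, hn0] at hξ
  have hc : ((n : ℂ) ^ (n + 1)) ≠ 0 := pow_ne_zero _ (Nat.cast_ne_zero.mpr hn0)
  obtain ⟨A, hA, hR, ht⟩ := dampedTraub_eq_div δ (n := n) (by omega)
  have hfix := traubPlane_root δ hξ
  have hd := hasDerivAt_traubPlane_root δ hn0 hξ
  obtain ⟨r, hr, hball⟩ := exists_ball_subset_planeBasin hξ0 hfix hd
  rw [immediateBasin, basin_eq_image_planeBasin (t := traubPlane n δ) hξ0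
    (fun z hz => by rw [sphereMap_coe_of_ne_zero hc hR hz, ht z hz])
    (fun y hy => sphereMap_zero_infty hc hA hR hy),
    OnePoint.isOpenEmbedding_coe.connectedComponentIn_image
      ((hball r le_rfl).2 (Metric.mem_ball_self hr)),
    OnePoint.isOpenEmbedding_coe.isEmbedding.isSimplyConnected_image]
  -- Rotation by this root of unity is the symmetry that keeps continua in the basin from
  -- surrounding `0`.
  have hω := Complex.isPrimitiveRoot_exp n hn0
  exact isSimplyConnected_component_planeBasin
    (fun z hz => differentiableAt_traubPlane δ hn0 hz) hξ0 hfix hd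
    (Complex.norm_eq_one_of_pow_eq_one hω.pow_eq_one hn0) (hω.ne_one (by omega))
    (fun z _ => traubPlane_mul δ (by omega) hω.pow_eq_one z)
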